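/- Let $N\ge 1$ be an integer, $p>1$ and $\gamma>0$. For $(y,s)\in\mathbb R^N\times\mathbb R$ and $\rho,\tau>0$ let $K_\rho(y)$ be the cube of edge $2\rho$ centred at $y$ and $(y,s)+Q_{\rho,\tau}=K_\rho(y)\times(s-\tau,s]$. Let $E\subset\mathbb R^N\times\mathbb R$ be open. Given a quantity $\mathcal A=\mathcal A(R,T,\rho,\tau)$, consider measurable functions $u$ on $E$ such that, for every $(y,s)+Q_{R,T}\Subset E$, $$u\in L^\infty\big(s-T,s;L^p(K_R(y))\big)\cap L^p\big(s-T,s;W^{1,p}(K_R(y))\big),$$ and, for all $0<\rho<R$, $0<\tau<T$ and $k\in\mathbb R$, $$\operatorname*{ess\,sup}_{s-\tau<t<s}\int_{K_\rho(y)}(u-k)_\pm^p(\cdot,t)\,dx+\iint_{(y,s)+Q_{\rho,\tau}}|D(u-k)_\pm|^p\,dx\,dt\le\Big[\frac{\mathcal A}{(R-\rho)^p}+\frac{\mathcal A}{T-\tau}\Big]\iint_{(y,s)+Q_{R,T}}(u-k)_\pm^p\,dx\,dt ,$$ where $D$ is the weak gradient in $x$. If $\mathcal A\equiv\gamma$ is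 constant, these functions form the parabolic De Giorgi class $\mathfrak A_p^\pm(E,\gamma)$. If $\mathcal A$ is a homogeneous quantity, meaning that $\mathcal A(R,T,\rho,\tau)$ is positive for $0<\rho<R$, $0<\tau<T$ and that under the relations $\rho=\sigma_1R$, $\tau=\sigma_2T$, $T=R^p$ it becomes a quantity of $\sigma_1,\sigma_2\in(0,1)$ alone (depending possibly also on the data $N,p,\gamma$), then $u$ is said to belong to the generalized class $\mathfrak A_p^\pm$ in $E$ with the quantity $\mathcal A$. **Lemma.** There is a homogeneous quantity $\mathcal A$, depending only on $N$, $p$ and $\gamma$, such that the following holds for every open set $E\subset\mathbb R^N\times\mathbb R$. Let $-\infty\le a<\infty$ and let $\varphi:(a,\infty)\to\mathbb R$ be convex and non-increasing, with $$\lim_{k\to\infty}\varphi(k)=\lim_{k\to\infty}k\,\varphi'(k)=0,$$ where $\varphi'$ denotes the right derivative. If $u\in\mathfrak A_p^-(E,\gamma)$ has range in $(a,\infty)$ (up to a null set), then $\varphi(u)$ belongs to the generalized class $\mathfrak A_p^+$ in $E$ with the quantity $\mathcal A$. -/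

import Mathlib

namespace ParabolicDeGiorgi

open MeasureTheory

/-- Space-time `ℝᴺ × ℝ`, with Lebesgue measure; `ℝᴺ` carries its Euclidean norm. -/
abbrev SpaceTime (N : ℕ) : Type := EuclideanSpace ℝ (Fin N) × ℝ

/-- The cube `K_ρ(y)` of edge `2ρ` centred at `y`. -/
def cube {N : ℕ} (y : EuclideanSpace ℝ (Fin N)) (ρ : ℝ) : Set (EuclideanSpace ℝ (Fin N)) :=
  {x | ∀ i, |x i - y i| < ρ}

/-- The cylinder `(y,s) + Q_{ρ,τ} = K_ρ(y) × (s - τ, s]`. -/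
def cyl {N : ℕ} (y : EuclideanSpace ℝ (Fin N)) (s ρ τ : ℝ) : Set (SpaceTime N) :=
  cube y ρ ×ˢ Set.Ioc (s - τ) s

/-- `v ∈ L^p(s - T, s; W^{1,p}(K_R(y)))`, with weak spatial gradient `G`: both `v` and `G` are in
`L^p` of the cylinder and, for almost every time `t`, the function `G(·,t)` is the weak gradient of
`v(·,t)` in the open cube `K_R(y)`, tested against smooth functions compactly supported there. -/
structure HasSpatialGradient {N : ℕ} (p : ℝ) (v : SpaceTime N → ℝ)
    (G : SpaceTime N → EuclideanSpace ℝ (Fin N))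
    (y : EuclideanSpace ℝ (Fin N)) (s R T : ℝ) : Prop where
  memLp : MemLp v (ENNReal.ofReal p) (volume.restrict (cyl y s R T))
  grad_memLp : MemLp G (ENNReal.ofReal p) (volume.restrict (cyl y s R T))
  weak : ∀ᵐ t ∂(volume.restrict (Set.Ioc (s - T) s)),
    ∀ ψ : EuclideanSpace ℝ (Fin N) → ℝ, ContDiff ℝ ((⊤ : ℕ∞) : WithTop ℕ∞) ψ →
      HasCompactSupport ψ → tsupport ψ ⊆ cube y R → ∀ i : Fin N,
        ∫ x in cube y R, v (x, t) * fderiv ℝ ψ x (EuclideanSpace.single i 1)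
          = - ∫ x in cube y R, G (x, t) i * ψ x

/-- `u ∈ L^∞(s - T, s; L^p(K_R(y))) ∩ L^p(s - T, s; W^{1,p}(K_R(y)))` -/
def InEnergySpace {N : ℕ} (p : ℝ) (u : SpaceTime N → ℝ)
    (y : EuclideanSpace ℝ (Fin N)) (s R T : ℝ) : Prop :=
  essSup (fun t => ∫⁻ x in cube y R, ‖u (x, t)‖ₑ ^ p) (volume.restrict (Set.Ioo (s - T) s)) < ⊤ ∧
    ∃ G : SpaceTime N → EuclideanSpace ℝ (Fin N), HasSpatialGradient p u G y s R T

/-- The energy inequality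
`ess sup_{s-τ<t<s} ∫_{K_ρ(y)} w(·,t)^p dx + ∬_{(y,s)+Q_{ρ,τ}} |G|^p dx dt
  ≤ [γ / (R-ρ)^p + γ / (T-τ)] ∬_{(y,s)+Q_{R,T}} w^p dx dt`
for a nonnegative function `w` with spatial gradient `G`, as an inequality in `[0,∞]`. -/
def EnergyInequality {N : ℕ} (p γ : ℝ) (w : SpaceTime N → ℝ)
    (G : SpaceTime N → EuclideanSpace ℝ (Fin N))
    (y : EuclideanSpace ℝ (Fin N)) (s R T ρ τ : ℝ) : Prop :=
  essSup (fun t => ∫⁻ x in cube y ρ, ENNReal.ofReal (w (x, t)) ^ p)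
      (volume.restrict (Set.Ioo (s - τ) s))
    + ∫⁻ z in cyl y s ρ τ, ‖G z‖ₑ ^ p
  ≤ ENNReal.ofReal (γ / (R - ρ) ^ p + γ / (T - τ)) *
      ∫⁻ z in cyl y s R T, ENNReal.ofReal (w z) ^ p

/-- Common form of the two classes: `trunc` is `r ↦ r⁺` or `r ↦ r⁻`, so that
`trunc (u - k) = (u - k)_±`, and the factor in front of the right-hand side may depend on
`R, T, ρ, τ` (in this order). The relation `(y,s) + Q_{R,T} ⋐ E` is `closure (cyl y s R T) ⊆ E`,
cylinders being bounded. -/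
structure MemDeGiorgi {N : ℕ} (trunc : ℝ → ℝ) (p : ℝ) (A : ℝ → ℝ → ℝ → ℝ → ℝ)
    (E : Set (SpaceTime N)) (u : SpaceTime N → ℝ) : Prop where
  measurable : AEMeasurable u (volume.restrict E)
  energySpace : ∀ (y : EuclideanSpace ℝ (Fin N)) (s R T : ℝ), 0 < R → 0 < T →
    closure (cyl y s R T) ⊆ E → InEnergySpace p u y s R T
  energy : ∀ (y : EuclideanSpace ℝ (Fin N)) (s R T : ℝ), 0 < R → 0 < T →
    closure (cyl y s R T) ⊆ E → ∀ k : ℝ,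
      ∃ G : SpaceTime N → EuclideanSpace ℝ (Fin N),
        HasSpatialGradient p (fun z => trunc (u z - k)) G y s R T ∧
        ∀ ρ τ : ℝ, 0 < ρ → ρ < R → 0 < τ → τ < T →
          EnergyInequality p (A R T ρ τ) (fun z => trunc (u z - k)) G y s R T ρ τ

/-- The parabolic De Giorgi class `𝔄_p^-(E, γ)`. -/
def ClassAMinus {N : ℕ} (p γ : ℝ) (E : Set (SpaceTime N)) (u : SpaceTime N → ℝ) : Prop :=
  MemDeGiorgi (fun r => r⁻) p (fun _ _ _ _ => γ) E u

/-- The class `𝔄_p^+` in `E` with `γ` replaced by a quantity `A(R, T, ρ, τ)`. -/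
def GeneralizedClassAPlus {N : ℕ} (p : ℝ) (A : ℝ → ℝ → ℝ → ℝ → ℝ)
    (E : Set (SpaceTime N)) (u : SpaceTime N → ℝ) : Prop :=
  MemDeGiorgi (fun r => r⁺) p A E u

/-- `A(R, T, ρ, τ)` is a positive homogeneous quantity: under the relations `ρ = σ₁ R`, `τ = σ₂ T`
and `T = R^p` it becomes a quantity of `σ₁` and `σ₂` alone. -/
structure IsHomogeneousQuantity (p : ℝ) (A : ℝ → ℝ → ℝ → ℝ → ℝ) : Prop where
  pos : ∀ R T ρ τ : ℝ, 0 < ρ → ρ < R → 0 < τ → τ < T → 0 < A R T ρ τ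
  homogeneous : ∃ f : ℝ → ℝ → ℝ, ∀ R σ₁ σ₂ : ℝ, 0 < R → 0 < σ₁ → σ₁ < 1 → 0 < σ₂ → σ₂ < 1 →
    A R (R ^ p) (σ₁ * R) (σ₂ * R ^ p) = f σ₁ σ₂

end ParabolicDeGiorgi

/-!
A convex nonincreasing function `ψ` vanishing at infinity is a superposition of truncations
`(k - ·)_+`, and the same should hold for its energy estimates. The point is to superpose `p`-th
powers: `exists_superposition` provides one measure `ν` for which `ψ(r) ^ p` is comparable with
`∫ (k - r)_+ ^ p ν(dk)`, while `ν (r, ∞)` dominates the `p`-th power of the slope of `ψ` at `r`. The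
chain rule gives `Dψ(u) = ψ'(u) Du`, so integrating the energy estimates for `(u - k)_-` against `ν`
yields those for `ψ(u)`, with a factor depending on `p` alone (`LevelEstimates.energy_convex`). The
function `(φ - k)_+` is convex and nonincreasing, but for `k < 0` its limit `c` at infinity is
positive; there `ψ = (φ - k)_+ - c`, and the constant `c` is absorbed by the term in `1 / (T - τ)`
(`LevelEstimates.energyInequality`). The quantity so obtained is a constant, in particular
homogeneous.

Membership of `φ(u)` in the energy space requires a bound for `φ` on the range of `u`, although `φ`
may blow up at `a`. On a smaller cylinder, `u` is bounded below by some `b > a`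
(`LevelEstimates.exists_ae_ge`), by De Giorgi's iteration: the excess below `b` is small on a larger
cylinder and hence vanishes on the smaller one. The gain in each step comes from an inequality of
Faber–Krahn type, `IsWeakGrad.lintegral_rpow_le_of_support`, proved by comparing a function with its
averages over small balls. On `[b, ∞)`, `φ` coincides with a Lipschitz convex function
(`exists_convex_extension`), to which the chain rule applies.

The weak gradients in the definition of the classes are unrelated to each other a priori. The chain
rule for piecewise differentiable Lipschitz functions, proved by mollification, and the uniqueness of
weak gradients identify all of them with `Du` on the sets `{u < k}`
(`ClassAMinus.exists_levelEstimates`).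
-/

namespace ParabolicDeGiorgi

open MeasureTheory Set Filter Topology

open scoped Convolution ENNReal NNReal

/-- The space `ℝᴺ` with its Euclidean norm. -/
abbrev Eucl (N : ℕ) : Type := EuclideanSpace ℝ (Fin N)

/-! ### Mollification -/

/-- Jensen's inequality for `r ↦ r ^ p` and a probability measure. -/
lemma rpow_lintegral_le_lintegral_rpow {α : Type*} [MeasurableSpace α] {μ : Measure α}
    [IsProbabilityMeasure μ] {f : α → ℝ≥0∞} (hf : AEMeasurable f μ) {p : ℝ} (hp : 1 ≤ p) :
    (∫⁻ x, f x ∂μ) ^ p ≤ ∫⁻ x, f x ^ p ∂μ := by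
  have h := eLpNorm'_le_eLpNorm'_of_exponent_le (f := f) one_pos hp μ hf.aestronglyMeasurable
  have hp0 : 0 < p := by linarith
  simp only [eLpNorm', enorm_eq_self, ENNReal.rpow_one, div_one] at h
  calc (∫⁻ x, f x ∂μ) ^ p ≤ ((∫⁻ x, f x ^ p ∂μ) ^ (1 / p)) ^ p := by gcongr
    _ = _ := by rw [← ENNReal.rpow_mul, one_div_mul_cancel hp0.ne', ENNReal.rpow_one]

/-- The bump functions whose normalizations are the mollifiers, with radii tending to `0`. -/
noncomputable def bump (N n : ℕ) : ContDiffBump (0 : Eucl N) where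
  rIn := 1 / (2 * (n + 1))
  rOut := 1 / (n + 1)
  rIn_pos := by positivity
  rIn_lt_rOut := by
    have : (0 : ℝ) ≤ n := by positivity
    exact one_div_lt_one_div_of_lt (by positivity) (by linarith)

/-- The mollifier of radius `1 / (n + 1)`: smooth, nonnegative, with integral `1`. -/
noncomputable def kernel (N n : ℕ) : Eucl N → ℝ := (bump N n).normed volume

/-- The mollification of `F` at scale `1 / (n + 1)`. -/
noncomputable def mollify {N : ℕ} {V : Type*} [NormedAddCommGroup V] [NormedSpace ℝ V] (n : ℕ)
    (F : Eucl N → V) : Eucl N → V :=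
  kernel N n ⋆[ContinuousLinearMap.lsmul ℝ ℝ, volume] F

lemma tendsto_bump_rOut (N : ℕ) : Tendsto (fun n => (bump N n).rOut) atTop (𝓝 0) :=
  tendsto_one_div_add_atTop_nhds_zero_nat

lemma kernel_nonneg (N n : ℕ) (x : Eucl N) : 0 ≤ kernel N n x := (bump N n).nonneg_normed x

lemma contDiff_kernel (N n : ℕ) : ContDiff ℝ ((⊤ : ℕ∞) : WithTop ℕ∞) (kernel N n) :=
  (bump N n).contDiff_normed

lemma hasCompactSupport_kernel (N n : ℕ) : HasCompactSupport (kernel N n) :=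
  (bump N n).hasCompactSupport_normed

lemma tsupport_kernel (N n : ℕ) : tsupport (kernel N n) = Metric.closedBall 0 (bump N n).rOut :=
  (bump N n).tsupport_normed_eq

lemma integrable_kernel (N n : ℕ) : Integrable (kernel N n) :=
  (bump N n).integrable_normed

lemma lintegral_kernel (N n : ℕ) : ∫⁻ x, ENNReal.ofReal (kernel N n x) = 1 := by
  rw [← ofReal_integral_eq_lintegral_ofReal (integrable_kernel N n)
    (ae_of_all _ (kernel_nonneg N n)), kernel, (bump N n).integral_normed, ENNReal.ofReal_one]

section

variable {N : ℕ} {V : Type*} [NormedAddCommGroup V] [NormedSpace ℝ V]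

lemma mollify_apply (n : ℕ) (F : Eucl N → V) (x : Eucl N) :
    mollify n F x = ∫ t, kernel N n t • F (x - t) := rfl

lemma ae_tendsto_mollify [CompleteSpace V] {F : Eucl N → V} (hF : LocallyIntegrable F) :
    ∀ᵐ x, Tendsto (fun n => mollify n F x) atTop (𝓝 (F x)) := by
  refine ContDiffBump.ae_convolution_tendsto_right_of_locallyIntegrable (K := 2)
    (tendsto_bump_rOut N) (Eventually.of_forall fun n => ?_) hF
  simp only [bump]
  apply le_of_eq
  field_simp

lemma contDiff_mollify (n : ℕ) {F : Eucl N → V} (hF : LocallyIntegrable F) :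
    ContDiff ℝ ((⊤ : ℕ∞) : WithTop ℕ∞) (mollify n F) :=
  (hasCompactSupport_kernel N n).contDiff_convolution_left _ (contDiff_kernel N n) hF

lemma enorm_mollify_le (n : ℕ) (F : Eucl N → V) (x : Eucl N) :
    ‖mollify n F x‖ₑ ≤ ∫⁻ t, ENNReal.ofReal (kernel N n t) * ‖F (x - t)‖ₑ := by
  rw [mollify_apply]
  refine (enorm_integral_le_lintegral_enorm _).trans_eq (lintegral_congr fun t => ?_)
  rw [enorm_smul, Real.enorm_of_nonneg (kernel_nonneg N n t)]

/-- Mollification does not increase the `L^p` norm. -/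
lemma lintegral_enorm_mollify_rpow_le (n : ℕ) {F : Eucl N → V} (hF : AEStronglyMeasurable F)
    {p : ℝ} (hp : 1 ≤ p) : ∫⁻ x, ‖mollify n F x‖ₑ ^ p ≤ ∫⁻ x, ‖F x‖ₑ ^ p := by
  set μ : Measure (Eucl N) := volume.withDensity fun t => ENNReal.ofReal (kernel N n t) with hμ
  have hk : Measurable fun t => ENNReal.ofReal (kernel N n t) :=
    (contDiff_kernel N n).continuous.measurable.ennreal_ofReal
  have : IsProbabilityMeasure μ := ⟨by simp [hμ, lintegral_kernel]⟩
  have hprod : AEMeasurable (fun q : Eucl N × Eucl N => ‖F (q.1 - q.2)‖ₑ)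
      ((volume : Measure (Eucl N)).prod volume) :=
    (hF.comp_quasiMeasurePreserving (quasiMeasurePreserving_sub_of_right_invariant _ _)).enorm
  have hx : ∀ x, AEMeasurable (fun t => ‖F (x - t)‖ₑ) (volume : Measure (Eucl N)) := fun x =>
    (hF.comp_quasiMeasurePreserving (quasiMeasurePreserving_sub_left _ x)).enorm
  calc ∫⁻ x, ‖mollify n F x‖ₑ ^ p
      ≤ ∫⁻ x, ∫⁻ t, ENNReal.ofReal (kernel N n t) * ‖F (x - t)‖ₑ ^ p := by
        refine lintegral_mono fun x => ?_
        calc ‖mollify n F x‖ₑ ^ p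
            ≤ (∫⁻ t, ENNReal.ofReal (kernel N n t) * ‖F (x - t)‖ₑ) ^ p := by
              gcongr; exact enorm_mollify_le n F x
          _ = (∫⁻ t, ‖F (x - t)‖ₑ ∂μ) ^ p := by
              rw [hμ, lintegral_withDensity_eq_lintegral_mul₀ hk.aemeasurable (hx x)]; rfl
          _ ≤ ∫⁻ t, ‖F (x - t)‖ₑ ^ p ∂μ :=
              rpow_lintegral_le_lintegral_rpow
                ((hx x).mono_ac (withDensity_absolutelyContinuous _ _)) hp
          _ = _ := by
              rw [hμ, lintegral_withDensity_eq_lintegral_mul₀ hk.aemeasurable ((hx x).pow_const p)]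
              rfl
    _ = ∫⁻ t, ∫⁻ x, ENNReal.ofReal (kernel N n t) * ‖F (x - t)‖ₑ ^ p :=
        lintegral_lintegral_swap
          ((hk.comp measurable_snd).aemeasurable.mul (hprod.pow_const p))
    _ = ∫⁻ t, ENNReal.ofReal (kernel N n t) * ∫⁻ x, ‖F x‖ₑ ^ p := by
        refine lintegral_congr fun t => ?_
        rw [lintegral_const_mul' _ _ ENNReal.ofReal_ne_top,
          lintegral_sub_right_eq_self (fun x => ‖F x‖ₑ ^ p) t]
    _ = ∫⁻ x, ‖F x‖ₑ ^ p := by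
        rw [lintegral_mul_const _ hk, lintegral_kernel, one_mul]

/-- Mollifications converge in `L¹`. Since they converge almost everywhere and do not increase the
`L¹` norm, this follows from Fatou's lemma. -/
lemma tendsto_lintegral_mollify_sub [CompleteSpace V] {F : Eucl N → V} (hF : Integrable F) :
    Tendsto (fun n => ∫⁻ x, ‖mollify n F x - F x‖ₑ) atTop (𝓝 0) := by
  have hcont : ∀ n, Continuous (mollify n F) := fun n =>
    (contDiff_mollify n hF.locallyIntegrable).continuous
  set I : ℝ≥0∞ := ∫⁻ x, ‖F x‖ₑ with hI
  have hIfin : I ≠ ∞ := hF.2.ne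
  have hle : ∀ n, ∫⁻ x, ‖mollify n F x‖ₑ ≤ I := fun n => by
    simpa using lintegral_enorm_mollify_rpow_le n hF.1 (le_refl (1 : ℝ))
  have hsub : ∀ n, AEMeasurable (fun x => ‖mollify n F x - F x‖ₑ) volume := fun n =>
    ((hcont n).aestronglyMeasurable.sub hF.1).enorm
  -- `‖Fₙ‖ + ‖F‖ - ‖Fₙ - F‖ ≥ 0` tends to `2 ‖F‖` almost everywhere
  set w : ℕ → Eucl N → ℝ≥0∞ := fun n x =>
    ‖mollify n F x‖ₑ + ‖F x‖ₑ - ‖mollify n F x - F x‖ₑ with hw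
  have hwm : ∀ n, AEMeasurable (w n) volume := fun n =>
    ((hcont n).enorm.aemeasurable.add hF.1.enorm).sub (hsub n)
  have hsum : ∀ n, (∫⁻ x, w n x) + ∫⁻ x, ‖mollify n F x - F x‖ₑ ≤ I + I := fun n => by
    rw [← lintegral_add_left' (hwm n)]
    calc ∫⁻ x, (w n x + ‖mollify n F x - F x‖ₑ) = ∫⁻ x, (‖mollify n F x‖ₑ + ‖F x‖ₑ) := by
          refine lintegral_congr fun x => ?_
          exact tsub_add_cancel_of_le enorm_sub_le
      _ ≤ I + I := by
          rw [lintegral_add_left' (hcont n).enorm.aemeasurable]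
          gcongr
          exact hle n
  have hlim : I + I ≤ liminf (fun n => ∫⁻ x, w n x) atTop := by
    calc I + I = ∫⁻ x, (‖F x‖ₑ + ‖F x‖ₑ) := by rw [lintegral_add_left' hF.1.enorm]
      _ = ∫⁻ x, liminf (fun n => w n x) atTop := by
          refine lintegral_congr_ae ?_
          filter_upwards [ae_tendsto_mollify hF.locallyIntegrable] with x hx
          refine (Tendsto.liminf_eq ?_).symm
          have h1 : Tendsto (fun n => ‖mollify n F x‖ₑ) atTop (𝓝 ‖F x‖ₑ) :=
            (continuous_enorm.tendsto _).comp hx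
          have h2 : Tendsto (fun n => ‖mollify n F x - F x‖ₑ) atTop (𝓝 0) := by
            have := (continuous_enorm.tendsto _).comp (hx.sub_const (F x))
            simpa only [Function.comp_def, sub_self, enorm_zero] using this
          simpa using ENNReal.Tendsto.sub (h1.add_const ‖F x‖ₑ) h2 (Or.inr ENNReal.zero_ne_top)
      _ ≤ _ := lintegral_liminf_le' hwm
  rw [ENNReal.tendsto_nhds_zero]
  intro ε hε
  by_cases hII : I + I = 0
  · filter_upwards with n
    have := hsum n
    rw [hII] at this
    have h0 := le_antisymm this (zero_le)
    rw [add_eq_zero] at h0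
    rw [h0.2]; exact zero_le
  · have hlt : I + I - ε < I + I :=
      ENNReal.sub_lt_self (ENNReal.add_ne_top.2 ⟨hIfin, hIfin⟩) hII hε.ne'
    filter_upwards [eventually_lt_of_lt_liminf (hlt.trans_le hlim)] with n hn
    have hfin : ∫⁻ x, w n x ≠ ∞ := ne_top_of_le_ne_top (ENNReal.add_ne_top.2 ⟨hIfin, hIfin⟩)
      (le_self_add.trans (hsum n))
    have h1 : I + I ≤ (∫⁻ x, w n x) + ε := tsub_le_iff_right.1 hn.le
    have h2 := (hsum n).trans h1
    exact (ENNReal.add_le_add_iff_left hfin).1 h2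

end

/-! ### Weak gradients on an open set -/

/-- `g` is the weak gradient of `f` on the open set `U`, tested against smooth functions compactly
supported in `U`. Integrability of `f` and `g` is not part of the definition. -/
def IsWeakGrad {N : ℕ} (U : Set (Eucl N)) (f : Eucl N → ℝ) (g : Eucl N → Eucl N) : Prop :=
  ∀ ψ : Eucl N → ℝ, ContDiff ℝ ((⊤ : ℕ∞) : WithTop ℕ∞) ψ → HasCompactSupport ψ →
    tsupport ψ ⊆ U → ∀ i : Fin N,
      ∫ x in U, f x * fderiv ℝ ψ x (EuclideanSpace.single i 1) = - ∫ x in U, g x i * ψ x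

section

variable {N : ℕ} {U : Set (Eucl N)} {f : Eucl N → ℝ} {g : Eucl N → Eucl N}

lemma IsWeakGrad.congr {f' : Eucl N → ℝ} {g' : Eucl N → Eucl N} (h : IsWeakGrad U f g)
    (hf : f =ᵐ[volume.restrict U] f') (hg : g =ᵐ[volume.restrict U] g') : IsWeakGrad U f' g' := by
  intro ψ hψ hc hs i
  have h1 : ∫ x in U, f' x * fderiv ℝ ψ x (EuclideanSpace.single i 1)
      = ∫ x in U, f x * fderiv ℝ ψ x (EuclideanSpace.single i 1) := by
    refine integral_congr_ae ?_
    filter_upwards [hf] with x hx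
    rw [hx]
  have h2 : ∫ x in U, g' x i * ψ x = ∫ x in U, g x i * ψ x := by
    refine integral_congr_ae ?_
    filter_upwards [hg] with x hx
    rw [hx]
  rw [h1, h2, h ψ hψ hc hs i]

lemma IsWeakGrad.mono {W : Set (Eucl N)} (h : IsWeakGrad U f g) (hU : MeasurableSet U)
    (hWU : W ⊆ U) : IsWeakGrad W f g := by
  intro ψ hψ hc hs i
  have key : ∀ F : Eucl N → ℝ, (∀ x, x ∉ tsupport ψ → F x = 0) →
      ∫ x in W, F x = ∫ x in U, F x := by
    intro F hF
    exact (setIntegral_eq_of_subset_of_forall_sdiff_eq_zero hU hWU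
      fun x hx => hF x fun hx' => hx.2 (hs hx')).symm
  rw [key, key, h ψ hψ hc (hs.trans hWU) i]
  · intro x hx
    rw [image_eq_zero_of_notMem_tsupport hx, mul_zero]
  · intro x hx
    have : fderiv ℝ ψ x = 0 := by
      by_contra h0
      exact hx (support_fderiv_subset ℝ h0)
    rw [this]; simp

/-- Weak gradients are unique. -/
lemma IsWeakGrad.unique {g' : Eucl N → Eucl N} (h : IsWeakGrad U f g) (h' : IsWeakGrad U f g')
    (hU : IsOpen U) (hg : IntegrableOn g U) (hg' : IntegrableOn g' U) :
    g =ᵐ[volume.restrict U] g' := by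
  have hcomp : ∀ {v : Eucl N → Eucl N}, IntegrableOn v U → ∀ i,
      IntegrableOn (fun x => v x i) U := fun hv i =>
    (EuclideanSpace.proj (𝕜 := ℝ) i : Eucl N →L[ℝ] ℝ).integrable_comp hv
  have hi : ∀ i : Fin N, ∀ᵐ x ∂(volume.restrict U), g x i = g' x i := by
    intro i
    have hint : IntegrableOn (fun x => g x i - g' x i) U := (hcomp hg i).sub (hcomp hg' i)
    have := hU.ae_eq_zero_of_integral_contDiff_smul_eq_zero (μ := volume)
      hint.locallyIntegrableOn ?_
    · rw [ae_restrict_iff' hU.measurableSet]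
      filter_upwards [this] with x hx hxU
      exact sub_eq_zero.1 (hx hxU)
    · intro ψ hψ hc hs
      have e1 : ∫ x, ψ x • (g x i - g' x i) = ∫ x in U, ψ x • (g x i - g' x i) := by
        refine (setIntegral_eq_integral_of_forall_compl_eq_zero fun x hx => ?_).symm
        rw [image_eq_zero_of_notMem_tsupport fun hx' => hx (hs hx'), zero_smul]
      have hb : ∃ C, ∀ x, ‖ψ x‖ ≤ C := hc.exists_bound_of_continuous hψ.continuous
      obtain ⟨C, hC⟩ := hb
      have hm : ∀ {v : Eucl N → ℝ}, IntegrableOn v U → IntegrableOn (fun x => v x * ψ x) U :=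
        fun hv => hv.mul_bdd (c := C) hψ.continuous.aestronglyMeasurable (ae_of_all _ hC)
      have e2 : ∫ x in U, ψ x • (g x i - g' x i)
          = (∫ x in U, g x i * ψ x) - ∫ x in U, g' x i * ψ x := by
        rw [← integral_sub (hm (hcomp hg i)) (hm (hcomp hg' i))]
        refine integral_congr_ae (ae_of_all _ fun x => ?_)
        simp only [smul_eq_mul]; ring
      rw [e1, e2]
      have a1 := h ψ hψ hc hs i
      have a2 := h' ψ hψ hc hs i
      linarith
  filter_upwards [ae_all_iff.2 hi] with x hx
  ext i
  exact hx i

/-- Away from the boundary of `U`, mollification commutes with the weak gradient. -/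
lemma IsWeakGrad.fderiv_mollify (h : IsWeakGrad U f g) (hU : MeasurableSet U)
    (hf : IntegrableOn f U) (hg : IntegrableOn g U) (n : ℕ) {x : Eucl N}
    (hx : Metric.closedBall x (bump N n).rOut ⊆ U) (v : Eucl N) :
    fderiv ℝ (mollify n (U.indicator f)) x v = inner ℝ (mollify n (U.indicator g) x) v := by
  have hF : LocallyIntegrable (U.indicator f) :=
    ((integrable_indicator_iff hU).2 hf).locallyIntegrable
  have hG : LocallyIntegrable (U.indicator g) :=
    ((integrable_indicator_iff hU).2 hg).locallyIntegrable
  have hk1 : ContDiff ℝ 1 (kernel N n) := (contDiff_kernel N n).of_le (by exact_mod_cast le_top)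
  -- the test function is the reflected kernel centred at `x`
  set ψ : Eucl N → ℝ := fun w => kernel N n (x - w) with hψ
  have hψd : ∀ w, HasFDerivAt ψ (-(fderiv ℝ (kernel N n) (x - w))) w := by
    intro w
    have h1 : HasFDerivAt (kernel N n) (fderiv ℝ (kernel N n) (x - w)) (x - w) :=
      ((hk1.differentiable (by norm_num)) _).hasFDerivAt
    have h2 : HasFDerivAt (fun w : Eucl N => x - w) (-(ContinuousLinearMap.id ℝ (Eucl N))) w :=
      (hasFDerivAt_id w).const_sub x
    have h3 := h1.comp w h2
    rwa [ContinuousLinearMap.comp_neg, ContinuousLinearMap.comp_id] at h3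
  have hψs : ContDiff ℝ ((⊤ : ℕ∞) : WithTop ℕ∞) ψ :=
    (contDiff_kernel N n).comp (contDiff_const.sub contDiff_id)
  have hψt : tsupport ψ ⊆ Metric.closedBall x (bump N n).rOut := by
    refine closure_minimal ?_ Metric.isClosed_closedBall
    intro w hw
    have : x - w ∈ tsupport (kernel N n) := subset_tsupport _ hw
    rw [tsupport_kernel, mem_closedBall_zero_iff] at this
    rwa [Metric.mem_closedBall, dist_comm, dist_eq_norm]
  have hψc : HasCompactSupport ψ :=
    HasCompactSupport.of_support_subset_isCompact (isCompact_closedBall x (bump N n).rOut)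
      ((subset_tsupport _).trans hψt)
  have hbasis : ∀ i : Fin N, fderiv ℝ (mollify n (U.indicator f)) x (EuclideanSpace.single i 1)
      = mollify n (U.indicator g) x i := by
    intro i
    have hd := (hasCompactSupport_kernel N n).hasFDerivAt_convolution_left
      (ContinuousLinearMap.lsmul ℝ ℝ : ℝ →L[ℝ] ℝ →L[ℝ] ℝ) hk1 hF x
    have hex : Integrable (fun t => kernel N n t • (U.indicator g) (x - t)) :=
      ((hasCompactSupport_kernel N n).convolutionExists_left (ContinuousLinearMap.lsmul ℝ ℝ)
        hk1.continuous hG x)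
    set L : ℝ →L[ℝ] ℝ →L[ℝ] ℝ := ContinuousLinearMap.lsmul ℝ ℝ with hL
    have hex' := ((hasCompactSupport_kernel N n).fderiv ℝ).convolutionExists_left
      (L.precompL (Eucl N)) (hk1.continuous_fderiv one_ne_zero) hF x
    rw [ConvolutionExistsAt] at hex'
    calc fderiv ℝ (mollify n (U.indicator f)) x (EuclideanSpace.single i 1)
        = ∫ t, fderiv ℝ (kernel N n) t (EuclideanSpace.single i 1) * (U.indicator f) (x - t) := by
          rw [mollify, hd.fderiv, convolution_def,
            ContinuousLinearMap.integral_apply hex']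
          simp [ContinuousLinearMap.precompL_apply, hL]
      _ = ∫ w, fderiv ℝ (kernel N n) (x - w) (EuclideanSpace.single i 1) * (U.indicator f) w := by
          rw [← integral_sub_left_eq_self _ volume x]
          simp
      _ = ∫ w in U, -(f w * fderiv ℝ ψ w (EuclideanSpace.single i 1)) := by
          rw [← integral_indicator hU]
          refine integral_congr_ae (ae_of_all _ fun w => ?_)
          by_cases hw : w ∈ U
          · simp [hw, (hψd w).fderiv, mul_comm]
          · simp [hw]
      _ = ∫ w in U, g w i * ψ w := by
          rw [integral_neg, h ψ hψs hψc (hψt.trans hx) i, neg_neg]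
      _ = ∫ w, ((kernel N n (x - w)) • (U.indicator g) w) i := by
          rw [← integral_indicator hU]
          refine integral_congr_ae (ae_of_all _ fun w => ?_)
          by_cases hw : w ∈ U
          · simp [hw, hψ, mul_comm]
          · simp [hw]
      _ = ∫ t, ((kernel N n t) • (U.indicator g) (x - t)) i := by
          rw [← integral_sub_left_eq_self _ volume x]
          simp
      _ = mollify n (U.indicator g) x i :=
          (EuclideanSpace.proj (𝕜 := ℝ) i : Eucl N →L[ℝ] ℝ).integral_comp_comm hex
  have hv : v = ∑ i, v i • EuclideanSpace.single i (1 : ℝ) := by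
    have := (EuclideanSpace.basisFun (Fin N) ℝ).sum_repr v
    simpa using this.symm
  conv_lhs => rw [hv]
  rw [map_sum, PiLp.inner_apply]
  refine Finset.sum_congr rfl fun i _ => ?_
  rw [map_smul, hbasis, smul_eq_mul]
  simp

end

/-! ### The chain rule for weak gradients -/

section

variable {N : ℕ} {U : Set (Eucl N)} {f : Eucl N → ℝ} {g : Eucl N → Eucl N}

lemma enorm_apply_le (v : Eucl N) (i : Fin N) : ‖v i‖ₑ ≤ ‖v‖ₑ := by
  rw [enorm_le_iff_norm_le]
  exact PiLp.norm_apply_le v i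

lemma integrableOn_apply {S : Set (Eucl N)} (hg : IntegrableOn g S) (i : Fin N) :
    IntegrableOn (fun x => g x i) S :=
  (EuclideanSpace.proj (𝕜 := ℝ) i : Eucl N →L[ℝ] ℝ).integrable_comp hg

/-- Chain rule for a `C¹` function with bounded derivative, by mollification. -/
lemma IsWeakGrad.comp_of_hasDerivAt (h : IsWeakGrad U f g) (hU : IsOpen U)
    (hf : IntegrableOn f U) (hg : IntegrableOn g U) {β β' : ℝ → ℝ} {L : ℝ≥0}
    (hβ : ∀ r, HasDerivAt β (β' r) r) (hβ' : Continuous β') (hL : ∀ r, ‖β' r‖ ≤ L) :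
    IsWeakGrad U (fun x => β (f x)) (fun x => β' (f x) • g x) := by
  intro ψ hψ hc hs i
  set e : Eucl N := EuclideanSpace.single i 1
  set F := U.indicator f with hFdef
  set G := U.indicator g with hGdef
  have hF : Integrable F := (integrable_indicator_iff hU.measurableSet).2 hf
  have hG : Integrable G := (integrable_indicator_iff hU.measurableSet).2 hg
  have hGi : Integrable (fun x => G x i) :=
    (EuclideanSpace.proj (𝕜 := ℝ) i : Eucl N →L[ℝ] ℝ).integrable_comp hG
  have hβc : Continuous β := continuous_iff_continuousAt.2 fun r => (hβ r).continuousAt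
  have hlip : LipschitzWith L β := lipschitzWith_of_nnnorm_deriv_le
    (fun r => (hβ r).differentiableAt) fun r => by rw [(hβ r).deriv]; exact hL r
  have hψc : Continuous ψ := hψ.continuous
  set Dψ : Eucl N → ℝ := fun x => fderiv ℝ ψ x e with hDψ
  have hDc : Continuous Dψ := (hψ.continuous_fderiv (by simp)).clm_apply continuous_const
  have hDcs : HasCompactSupport Dψ := hc.fderiv_apply ℝ e
  have hD0 : ∀ x, x ∉ tsupport ψ → Dψ x = 0 := fun x hx => by
    have : fderiv ℝ ψ x = 0 := by
      by_contra h0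
      exact hx (support_fderiv_subset ℝ h0)
    rw [hDψ]; simp [this]
  obtain ⟨C, hC⟩ := hc.exists_bound_of_continuous hψc
  obtain ⟨C', hC'⟩ := hDcs.exists_bound_of_continuous hDc
  obtain ⟨δ, hδ, hδU⟩ := hc.exists_cthickening_subset_open hU hs
  have hball : ∀ᶠ n in atTop, ∀ x ∈ tsupport ψ, Metric.closedBall x (bump N n).rOut ⊆ U := by
    filter_upwards [(tendsto_bump_rOut N).eventually (gt_mem_nhds hδ)] with n hn x hx
    exact ((Metric.closedBall_subset_closedBall hn.le).trans
      (Metric.closedBall_subset_cthickening hx δ)).trans hδU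
  have hsm : ∀ n, ContDiff ℝ ((⊤ : ℕ∞) : WithTop ℕ∞) (mollify n F) := fun n =>
    contDiff_mollify n hF.locallyIntegrable
  have hGc : ∀ n, Continuous (mollify n G) := fun n =>
    (contDiff_mollify n hG.locallyIntegrable).continuous
  have hGic : ∀ n, Continuous fun x => mollify n G x i := fun n =>
    (EuclideanSpace.proj (𝕜 := ℝ) i : Eucl N →L[ℝ] ℝ).continuous.comp (hGc n)
  -- integration by parts for the mollified functions
  have hparts : ∀ᶠ n in atTop, ∫ x, β (mollify n F x) * Dψ x
      = -∫ x, β' (mollify n F x) * (mollify n G x i) * ψ x := by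
    filter_upwards [hball] with n hn
    have hdF : ∀ x, HasFDerivAt (fun x => β (mollify n F x))
        (β' (mollify n F x) • fderiv ℝ (mollify n F) x) x := fun x =>
      (hβ _).comp_hasFDerivAt x ((hsm n).differentiable (by simp) x).hasFDerivAt
    have hc1 : Continuous fun x => β (mollify n F x) := hβc.comp (hsm n).continuous
    have hc2 : Continuous fun x => fderiv ℝ (fun x => β (mollify n F x)) x e := by
      have : (fun x => fderiv ℝ (fun x => β (mollify n F x)) x e)
          = fun x => β' (mollify n F x) * fderiv ℝ (mollify n F) x e := by
        funext x; rw [(hdF x).fderiv]; rfl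
      rw [this]
      exact (hβ'.comp (hsm n).continuous).mul
        (((hsm n).continuous_fderiv (by simp)).clm_apply continuous_const)
    rw [integral_mul_fderiv_eq_neg_fderiv_mul_of_integrable
      ((hc2.mul hψc).integrable_of_hasCompactSupport hc.mul_left)
      ((hc1.mul hDc).integrable_of_hasCompactSupport hDcs.mul_left)
      ((hc1.mul hψc).integrable_of_hasCompactSupport hc.mul_left)
      (fun x _ => (hdF x).differentiableAt) (fun x _ => hψ.differentiable (by simp) x)]
    congr 1
    refine integral_congr_ae (ae_of_all _ fun x => ?_)
    by_cases hx : x ∈ tsupport ψ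
    · have h1 := h.fderiv_mollify hU.measurableSet hf hg n (hn x hx) e
      rw [EuclideanSpace.inner_single_right, one_mul] at h1
      simp only [(hdF x).fderiv, smul_apply, smul_eq_mul]
      rw [h1]
      rfl
    · simp [image_eq_zero_of_notMem_tsupport hx]
  -- passage to the limit on the left
  have hβF : Integrable fun x => β (F x) * Dψ x := by
    have h1 : Integrable fun x => β (F x) - β 0 := by
      refine (hF.norm.const_mul (L : ℝ)).mono'
        ((hβc.comp_aestronglyMeasurable hF.1).sub aestronglyMeasurable_const)
        (ae_of_all _ fun x => ?_)
      simpa using hlip.norm_sub_le (F x) 0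
    have h2 := (h1.mul_bdd (c := C') hDc.aestronglyMeasurable (ae_of_all _ hC')).add
      ((hDc.integrable_of_hasCompactSupport hDcs).const_mul (β 0))
    refine h2.congr (ae_of_all _ fun x => ?_)
    simp only [Pi.add_apply]; ring
  have hleft : Tendsto (fun n => ∫ x, β (mollify n F x) * Dψ x) atTop
      (𝓝 (∫ x, β (F x) * Dψ x)) := by
    refine tendsto_integral_of_L1 _ hβF.1 (Eventually.of_forall fun n =>
      ((hβc.comp (hsm n).continuous).mul hDc).integrable_of_hasCompactSupport hDcs.mul_left) ?_
    have hz := ENNReal.Tendsto.const_mul (a := (L : ℝ≥0∞) * ENNReal.ofReal C')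
      (tendsto_lintegral_mollify_sub hF)
      (Or.inr (ENNReal.mul_ne_top ENNReal.coe_ne_top ENNReal.ofReal_ne_top))
    rw [mul_zero] at hz
    refine tendsto_of_tendsto_of_tendsto_of_le_of_le tendsto_const_nhds hz (fun _ => zero_le)
      fun n => ?_
    simp only
    rw [← lintegral_const_mul' _ _ (ENNReal.mul_ne_top ENNReal.coe_ne_top ENNReal.ofReal_ne_top)]
    refine lintegral_mono fun x => ?_
    rw [← sub_mul, enorm_mul]
    calc ‖β (mollify n F x) - β (F x)‖ₑ * ‖Dψ x‖ₑ
        ≤ (L * ‖mollify n F x - F x‖ₑ) * ENNReal.ofReal C' := by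
          gcongr
          · have := hlip (mollify n F x) (F x)
            rwa [edist_eq_enorm_sub, edist_eq_enorm_sub] at this
          · rw [← ofReal_norm]
            exact ENNReal.ofReal_le_ofReal (hC' x)
      _ = _ := by ring
  -- passage to the limit on the right
  have hright1 : Tendsto (fun n => ∫ x, β' (mollify n F x) * (mollify n G x i - G x i) * ψ x) atTop
      (𝓝 (∫ x : Eucl N, (0 : ℝ))) := by
    have hz := ENNReal.Tendsto.const_mul (a := (L : ℝ≥0∞) * ENNReal.ofReal C)
      (tendsto_lintegral_mollify_sub hG)
      (Or.inr (ENNReal.mul_ne_top ENNReal.coe_ne_top ENNReal.ofReal_ne_top))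
    rw [mul_zero] at hz
    have hb : ∀ n x, ‖β' (mollify n F x) * (mollify n G x i - G x i) * ψ x‖ₑ
        ≤ (L : ℝ≥0∞) * ENNReal.ofReal C * ‖mollify n G x - G x‖ₑ := fun n x => by
      rw [enorm_mul, enorm_mul]
      calc ‖β' (mollify n F x)‖ₑ * ‖mollify n G x i - G x i‖ₑ * ‖ψ x‖ₑ
          ≤ L * ‖mollify n G x - G x‖ₑ * ENNReal.ofReal C := by
            gcongr
            · rw [← ofReal_norm, ← ENNReal.ofReal_coe_nnreal]
              exact ENNReal.ofReal_le_ofReal (hL _)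
            · exact enorm_apply_le (mollify n G x - G x) i
            · rw [← ofReal_norm]
              exact ENNReal.ofReal_le_ofReal (hC x)
        _ = _ := by ring
    have hm : ∀ n, Integrable fun x => β' (mollify n F x) * (mollify n G x i) * ψ x := fun n =>
      (((hβ'.comp (hsm n).continuous).mul (hGic n)).mul hψc).integrable_of_hasCompactSupport
        hc.mul_left
    have hm' : ∀ n, Integrable fun x => β' (mollify n F x) * (G x i) * ψ x := fun n =>
      (hGi.bdd_mul (c := L) (hβ'.comp (hsm n).continuous).aestronglyMeasurable
        (ae_of_all _ fun x => hL _)).mul_bdd (c := C) hψc.aestronglyMeasurable (ae_of_all _ hC)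
    refine tendsto_integral_of_L1 _ aestronglyMeasurable_const
      (Eventually.of_forall fun n => ?_) ?_
    · refine ((hm n).sub (hm' n)).congr (ae_of_all _ fun x => ?_)
      simp only [Pi.sub_apply]; ring
    · refine tendsto_of_tendsto_of_tendsto_of_le_of_le tendsto_const_nhds hz (fun _ => zero_le)
        fun n => ?_
      simp only [sub_zero]
      rw [← lintegral_const_mul' _ _ (ENNReal.mul_ne_top ENNReal.coe_ne_top ENNReal.ofReal_ne_top)]
      exact lintegral_mono fun x => hb n x
  have hright2 : Tendsto (fun n => ∫ x, β' (mollify n F x) * G x i * ψ x) atTop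
      (𝓝 (∫ x, β' (F x) * G x i * ψ x)) := by
    refine tendsto_integral_of_dominated_convergence (fun x => L * ‖G x i‖ * C) (fun n => ?_)
      ((hGi.norm.const_mul _).mul_const _) (fun n => ae_of_all _ fun x => ?_) ?_
    · exact ((hβ'.comp (hsm n).continuous).aestronglyMeasurable.mul hGi.1).mul
        hψc.aestronglyMeasurable
    · rw [norm_mul, norm_mul]
      gcongr
      · exact hL _
      · exact hC x
    · filter_upwards [ae_tendsto_mollify hF.locallyIntegrable] with x hx
      exact (((hβ'.tendsto _).comp hx).mul_const _).mul_const _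
  have hright : Tendsto (fun n => -∫ x, β' (mollify n F x) * (mollify n G x i) * ψ x) atTop
      (𝓝 (-∫ x, β' (F x) * G x i * ψ x)) := by
    have := (hright1.add hright2).neg
    simp only [integral_zero, zero_add] at this
    refine this.congr fun n => ?_
    rw [← integral_add]
    · congr 1
      refine integral_congr_ae (ae_of_all _ fun x => ?_)
      simp only; ring
    · have hm : Integrable fun x => β' (mollify n F x) * (mollify n G x i) * ψ x :=
        (((hβ'.comp (hsm n).continuous).mul (hGic n)).mul hψc).integrable_of_hasCompactSupport
          hc.mul_left
      have hm' : Integrable fun x => β' (mollify n F x) * (G x i) * ψ x :=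
        (hGi.bdd_mul (c := L) (hβ'.comp (hsm n).continuous).aestronglyMeasurable
          (ae_of_all _ fun x => hL _)).mul_bdd (c := C) hψc.aestronglyMeasurable (ae_of_all _ hC)
      refine (hm.sub hm').congr (ae_of_all _ fun x => ?_)
      simp only [Pi.sub_apply]; ring
    · exact (hGi.bdd_mul (c := L) (hβ'.comp (hsm n).continuous).aestronglyMeasurable
          (ae_of_all _ fun x => hL _)).mul_bdd (c := C) hψc.aestronglyMeasurable (ae_of_all _ hC)
  have hlim := tendsto_nhds_unique (hleft.congr' hparts) hright
  have e1 : ∫ x in U, β (f x) * Dψ x = ∫ x, β (F x) * Dψ x := by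
    rw [← integral_indicator hU.measurableSet]
    refine integral_congr_ae (ae_of_all _ fun x => ?_)
    by_cases hx : x ∈ U
    · simp [hx, hFdef]
    · simp [hx, hD0 x fun hx' => hx (hs hx')]
  have e2 : ∫ x in U, (β' (f x) • g x) i * ψ x = ∫ x, β' (F x) * G x i * ψ x := by
    rw [← integral_indicator hU.measurableSet]
    refine integral_congr_ae (ae_of_all _ fun x => ?_)
    by_cases hx : x ∈ U
    · simp [hx, hFdef, hGdef]
    · simp [hx, image_eq_zero_of_notMem_tsupport fun hx' => hx (hs hx')]
  rw [e1, e2, hlim]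

/-- Chain rule for a Lipschitz function `β` with a right derivative `d` at every point. No condition
on the level sets of `f` is needed, since `β` is the limit of the averages
`m ∫_r^{r + 1/m} β`, whose derivatives are difference quotients converging to `d` everywhere. -/
lemma IsWeakGrad.comp_lipschitz (h : IsWeakGrad U f g) (hU : IsOpen U)
    (hf : IntegrableOn f U) (hg : IntegrableOn g U) {β d : ℝ → ℝ} {L : ℝ≥0}
    (hβ : LipschitzWith L β) (hd : ∀ r, HasDerivWithinAt β (d r) (Ioi r) r) :
    IsWeakGrad U (fun x => β (f x)) (fun x => d (f x) • g x) := by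
  intro ψ hψ hc hs i
  have hβc := hβ.continuous
  set ε : ℕ → ℝ := fun n => 1 / ((n : ℝ) + 1) with hε
  have hε0 : ∀ n, 0 < ε n := fun n => Nat.one_div_pos_of_nat
  have hε1 : ∀ n, ε n ≤ 1 := fun n => by
    rw [hε]
    exact (div_le_one (by positivity)).2 (by simp)
  have hεt : Tendsto ε atTop (𝓝 0) := tendsto_one_div_add_atTop_nhds_zero_nat
  set b : ℕ → ℝ → ℝ := fun n r => (ε n)⁻¹ * ∫ v in r..r + ε n, β v with hb
  set b' : ℕ → ℝ → ℝ := fun n r => (ε n)⁻¹ * (β (r + ε n) - β r) with hb'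
  have hbd : ∀ n r, HasDerivAt (b n) (b' n r) r := by
    intro n r
    have hint : ∀ a c : ℝ, IntervalIntegrable β volume a c := fun a c =>
      hβc.intervalIntegrable a c
    have h1 : HasDerivAt (fun r => ∫ v in (0 : ℝ)..r, β v) (β r) r :=
      hβc.integral_hasStrictDerivAt 0 r |>.hasDerivAt
    have h2 : HasDerivAt (fun r => ∫ v in (0 : ℝ)..r + ε n, β v) (β (r + ε n)) r :=
      ((hβc.integral_hasStrictDerivAt 0 (r + ε n)).hasDerivAt).comp_add_const r (ε n)
    have h3 := (h2.sub h1).const_mul (ε n)⁻¹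
    refine h3.congr_of_eventuallyEq (Eventually.of_forall fun r => ?_)
    simp only [hb, Pi.sub_apply]
    rw [intervalIntegral.integral_interval_sub_left (hint _ _) (hint _ _)]
  have hb'L : ∀ n r, ‖b' n r‖ ≤ L := by
    intro n r
    rw [hb', norm_mul, norm_inv, Real.norm_of_nonneg (hε0 n).le, inv_mul_le_iff₀ (hε0 n)]
    have := hβ.norm_sub_le (r + ε n) r
    simpa [Real.norm_of_nonneg (hε0 n).le, abs_of_pos (hε0 n), mul_comm] using this
  have hb'c : ∀ n, Continuous (b' n) := fun n => by fun_prop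
  have hbβ : ∀ n r, ‖b n r - β r‖ ≤ L * ε n := by
    intro n r
    have h1 : b n r - β r = (ε n)⁻¹ * ∫ v in r..r + ε n, (β v - β r) := by
      rw [intervalIntegral.integral_sub (hβc.intervalIntegrable _ _)
        (continuous_const.intervalIntegrable _ _), intervalIntegral.integral_const, hb]
      have := (hε0 n).ne'
      simp only [add_sub_cancel_left, smul_eq_mul]
      field_simp
    have h2 : ‖∫ v in r..r + ε n, (β v - β r)‖ ≤ (L * ε n) * |r + ε n - r| := by
      refine intervalIntegral.norm_integral_le_of_norm_le_const fun v hv => ?_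
      rw [uIoc_of_le (by linarith [hε0 n])] at hv
      refine (hβ.norm_sub_le v r).trans ?_
      gcongr
      rw [Real.norm_of_nonneg (by linarith [hv.1])]
      linarith [hv.2]
    rw [add_sub_cancel_left, abs_of_pos (hε0 n)] at h2
    rw [h1, norm_mul, norm_inv, Real.norm_of_nonneg (hε0 n).le, inv_mul_le_iff₀ (hε0 n)]
    linarith
  have hbt : ∀ r, Tendsto (fun n => b n r) atTop (𝓝 (β r)) := by
    intro r
    rw [tendsto_iff_norm_sub_tendsto_zero]
    refine squeeze_zero (fun _ => norm_nonneg _) (fun n => hbβ n r) ?_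
    simpa using hεt.const_mul (L : ℝ)
  have hb't : ∀ r, Tendsto (fun n => b' n r) atTop (𝓝 (d r)) := by
    intro r
    have h1 := hasDerivWithinAt_iff_tendsto_slope.1 (hd r)
    have h2 : Tendsto (fun n => r + ε n) atTop (𝓝[Ioi r \ {r}] r) := by
      refine tendsto_nhdsWithin_iff.2 ⟨by simpa using hεt.const_add r, ?_⟩
      exact Eventually.of_forall fun n =>
        ⟨by simp [hε0 n], by simp [(hε0 n).ne']⟩
    refine (h1.comp h2).congr fun n => ?_
    simp [slope_def_field, hb', div_eq_inv_mul]
  obtain ⟨C, hC⟩ := hc.exists_bound_of_continuous hψ.continuous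
  set e : Eucl N := EuclideanSpace.single i 1
  set Dψ : Eucl N → ℝ := fun x => fderiv ℝ ψ x e with hDψ
  have hDc : Continuous Dψ := (hψ.continuous_fderiv (by simp)).clm_apply continuous_const
  have hDcs : HasCompactSupport Dψ := hc.fderiv_apply ℝ e
  obtain ⟨C', hC'⟩ := hDcs.exists_bound_of_continuous hDc
  have hgi := integrableOn_apply hg i
  have hbc : ∀ n, Continuous (b n) := fun n =>
    continuous_iff_continuousAt.2 fun r => (hbd n r).continuousAt
  have hleft : Tendsto (fun n => ∫ x in U, b n (f x) * Dψ x) atTop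
      (𝓝 (∫ x in U, β (f x) * Dψ x)) := by
    refine tendsto_integral_of_dominated_convergence
      (fun x => (L * ‖f x‖) * C' + (‖β 0‖ + L) * ‖Dψ x‖) (fun n => ?_) ?_
      (fun n => ae_of_all _ fun x => ?_) (ae_of_all _ fun x => (hbt _).mul_const _)
    · exact ((hbc n).comp_aestronglyMeasurable hf.1).mul hDc.aestronglyMeasurable
    · exact ((hf.norm.const_mul _).mul_const _).add
        (((hDc.integrable_of_hasCompactSupport hDcs).norm.const_mul _).integrableOn)
    · have h1 : ‖b n (f x)‖ ≤ L * ‖f x‖ + (‖β 0‖ + L) := by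
        have a1 := hbβ n (f x)
        have a2 := hβ.norm_sub_le (f x) 0
        have a3 : (L : ℝ) * ε n ≤ L := mul_le_of_le_one_right L.2 (hε1 n)
        rw [sub_zero] at a2
        have a4 : b n (f x) = (b n (f x) - β (f x)) + (β (f x) - β 0) + β 0 := by ring
        rw [a4]
        refine (norm_add₃_le).trans ?_
        linarith
      rw [norm_mul]
      calc ‖b n (f x)‖ * ‖Dψ x‖ ≤ (L * ‖f x‖ + (‖β 0‖ + L)) * ‖Dψ x‖ := by gcongr
        _ = (L * ‖f x‖) * ‖Dψ x‖ + (‖β 0‖ + L) * ‖Dψ x‖ := by ring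
        _ ≤ _ := by gcongr; exact hC' x
  have hright : Tendsto (fun n => -∫ x in U, (b' n (f x) • g x) i * ψ x) atTop
      (𝓝 (-∫ x in U, (d (f x) • g x) i * ψ x)) := by
    refine (tendsto_integral_of_dominated_convergence (fun x => L * ‖g x i‖ * C) (fun n => ?_)
      ((hgi.norm.const_mul _).mul_const _) (fun n => ae_of_all _ fun x => ?_)
      (ae_of_all _ fun x => ?_)).neg
    · exact (((hb'c n).comp_aestronglyMeasurable hf.1).mul hgi.1).mul
        hψ.continuous.aestronglyMeasurable
    · simp only [PiLp.smul_apply, smul_eq_mul]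
      rw [norm_mul, norm_mul]
      gcongr
      · exact hb'L _ _
      · exact hC x
    · simp only [PiLp.smul_apply, smul_eq_mul]
      exact ((hb't _).mul_const _).mul_const _
  refine tendsto_nhds_unique (hleft.congr fun n => ?_) hright
  exact h.comp_of_hasDerivAt hU hf hg (hbd n) (hb'c n) (hb'L n) ψ hψ hc hs i

end

/-! ### Translations and functions of small support -/

section

variable {N : ℕ} {U V : Set (Eucl N)} {f : Eucl N → ℝ} {g : Eucl N → Eucl N}

/-- The `L^p` modulus of continuity of a function with a weak gradient in `L^p`. -/
lemma IsWeakGrad.lintegral_sub_translate_le (h : IsWeakGrad U f g) (hU : IsOpen U)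
    (hf : IntegrableOn f U) (hg : IntegrableOn g U) (hV : MeasurableSet V) {z : Eucl N} {ε : ℝ}
    (hε : 0 < ε) (hVU : ∀ x ∈ V, Metric.closedBall x (‖z‖ + ε) ⊆ U) {p : ℝ} (hp : 1 ≤ p) :
    ∫⁻ x in V, ‖f x - f (x - z)‖ₑ ^ p ≤ ‖z‖ₑ ^ p * ∫⁻ x in U, ‖g x‖ₑ ^ p := by
  set F := U.indicator f with hFdef
  set G := U.indicator g with hGdef
  have hp0 : 0 < p := by linarith
  have hF : Integrable F := (integrable_indicator_iff hU.measurableSet).2 hf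
  have hG : Integrable G := (integrable_indicator_iff hU.measurableSet).2 hg
  have hsm : ∀ n, ContDiff ℝ ((⊤ : ℕ∞) : WithTop ℕ∞) (mollify n F) := fun n =>
    contDiff_mollify n hF.locallyIntegrable
  have hGc : ∀ n, Continuous (mollify n G) := fun n =>
    (contDiff_mollify n hG.locallyIntegrable).continuous
  have hprob : IsProbabilityMeasure ((volume : Measure ℝ).restrict (Ioc 0 1)) := ⟨by simp⟩
  -- the estimate for the mollified functions, from the fundamental theorem of calculus
  have hsmooth : ∀ᶠ n in atTop,
      ∫⁻ x in V, ‖mollify n F x - mollify n F (x - z)‖ₑ ^ p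
        ≤ ‖z‖ₑ ^ p * ∫⁻ x in U, ‖g x‖ₑ ^ p := by
    filter_upwards [(tendsto_bump_rOut N).eventually (gt_mem_nhds hε)] with n hn
    have hpt : ∀ x ∈ V, ‖mollify n F x - mollify n F (x - z)‖ₑ
        ≤ ∫⁻ s in Ioc (0 : ℝ) 1, ‖mollify n G (x - s • z)‖ₑ * ‖z‖ₑ := by
      intro x hx
      have hder : ∀ s ∈ uIcc (0 : ℝ) 1, HasDerivAt (fun s : ℝ => mollify n F (x - s • z))
          (inner ℝ (mollify n G (x - s • z)) (-z)) s := by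
        intro s hs
        rw [uIcc_of_le zero_le_one] at hs
        have hb : Metric.closedBall (x - s • z) (bump N n).rOut ⊆ U := by
          refine Subset.trans (Metric.closedBall_subset_closedBall' ?_) (hVU x hx)
          have : dist (x - s • z) x ≤ ‖z‖ := by
            rw [dist_eq_norm, sub_sub_cancel_left, norm_neg, norm_smul, Real.norm_of_nonneg hs.1]
            exact mul_le_of_le_one_left (norm_nonneg _) hs.2
          linarith
        rw [← h.fderiv_mollify hU.measurableSet hf hg n hb]
        have hl : HasDerivAt (fun s : ℝ => x - s • z) (-z) s := by
          simpa using ((hasDerivAt_id s).smul_const z).const_sub x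
        exact (((hsm n).differentiable (by simp) _).hasFDerivAt).comp_hasDerivAt s hl
      have hcont : Continuous fun s : ℝ => inner ℝ (mollify n G (x - s • z)) (-z) := by
        have := hGc n
        fun_prop
      have hftc := intervalIntegral.integral_eq_sub_of_hasDerivAt hder
        (hcont.intervalIntegrable _ _)
      simp only [one_smul, zero_smul, sub_zero] at hftc
      rw [← enorm_neg, neg_sub, ← hftc, intervalIntegral.integral_of_le zero_le_one]
      refine (enorm_integral_le_lintegral_enorm _).trans (lintegral_mono fun s => ?_)
      rw [← enorm_neg z, enorm_eq_nnnorm, enorm_eq_nnnorm, enorm_eq_nnnorm, ← ENNReal.coe_mul,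
        ENNReal.coe_le_coe]
      exact nnnorm_inner_le_nnnorm _ _
    have hjm : Measurable fun q : Eucl N × ℝ => (‖mollify n G (q.1 - q.2 • z)‖ₑ * ‖z‖ₑ) ^ p := by
      have : Continuous fun q : Eucl N × ℝ => mollify n G (q.1 - q.2 • z) := by
        have := hGc n
        fun_prop
      exact (this.enorm.measurable.mul_const _).pow_const p
    calc ∫⁻ x in V, ‖mollify n F x - mollify n F (x - z)‖ₑ ^ p
        ≤ ∫⁻ x in V, ∫⁻ s in Ioc (0 : ℝ) 1, (‖mollify n G (x - s • z)‖ₑ * ‖z‖ₑ) ^ p := by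
          refine setLIntegral_mono' hV fun x hx => ?_
          have hm : Continuous fun s : ℝ => mollify n G (x - s • z) := by
            have := hGc n
            fun_prop
          calc _ ≤ (∫⁻ s in Ioc (0 : ℝ) 1, ‖mollify n G (x - s • z)‖ₑ * ‖z‖ₑ) ^ p := by
                gcongr; exact hpt x hx
            _ ≤ _ := rpow_lintegral_le_lintegral_rpow
                (hm.enorm.measurable.mul_const _).aemeasurable hp
      _ ≤ ∫⁻ x, ∫⁻ s in Ioc (0 : ℝ) 1, (‖mollify n G (x - s • z)‖ₑ * ‖z‖ₑ) ^ p :=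
          setLIntegral_le_lintegral _ _
      _ = ∫⁻ s in Ioc (0 : ℝ) 1, ∫⁻ x, (‖mollify n G (x - s • z)‖ₑ * ‖z‖ₑ) ^ p :=
          lintegral_lintegral_swap hjm.aemeasurable
      _ = ∫⁻ s in Ioc (0 : ℝ) 1, ‖z‖ₑ ^ p * ∫⁻ x, ‖mollify n G x‖ₑ ^ p := by
          refine lintegral_congr fun s => ?_
          rw [lintegral_sub_right_eq_self (fun x => (‖mollify n G x‖ₑ * ‖z‖ₑ) ^ p) (s • z)]
          simp_rw [ENNReal.mul_rpow_of_nonneg _ _ hp0.le]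
          rw [lintegral_mul_const _ ((hGc n).enorm.measurable.pow_const p), mul_comm]
      _ = ‖z‖ₑ ^ p * ∫⁻ x, ‖mollify n G x‖ₑ ^ p := by simp
      _ ≤ ‖z‖ₑ ^ p * ∫⁻ x, ‖G x‖ₑ ^ p := by
          exact mul_le_mul_right (lintegral_enorm_mollify_rpow_le n hG.1 hp) _
      _ = ‖z‖ₑ ^ p * ∫⁻ x in U, ‖g x‖ₑ ^ p := by
          rw [← lintegral_indicator hU.measurableSet]
          congr 1
          refine lintegral_congr fun x => ?_
          by_cases hx : x ∈ U <;> simp [hGdef, hx, hp0]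
  have hcongr : ∫⁻ x in V, ‖f x - f (x - z)‖ₑ ^ p = ∫⁻ x in V, ‖F x - F (x - z)‖ₑ ^ p := by
    refine setLIntegral_congr_fun hV fun x hx => ?_
    have h1 : x ∈ U := hVU x hx (Metric.mem_closedBall_self (by positivity))
    have h2 : x - z ∈ U := hVU x hx (by
      rw [Metric.mem_closedBall, dist_eq_norm, sub_sub_cancel_left, norm_neg]; linarith)
    simp [hFdef, h1, h2]
  rw [hcongr]
  have hae : ∀ᵐ x, Tendsto (fun n => mollify n F x) atTop (𝓝 (F x)) :=
    ae_tendsto_mollify hF.locallyIntegrable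
  have hae' : ∀ᵐ x, Tendsto (fun n => mollify n F (x - z)) atTop (𝓝 (F (x - z))) :=
    (measurePreserving_sub_right volume z).quasiMeasurePreserving.ae hae
  calc ∫⁻ x in V, ‖F x - F (x - z)‖ₑ ^ p
      = ∫⁻ x in V, liminf (fun n => ‖mollify n F x - mollify n F (x - z)‖ₑ ^ p) atTop := by
        refine lintegral_congr_ae (ae_restrict_of_ae ?_)
        filter_upwards [hae, hae'] with x h1 h2
        exact (((ENNReal.continuous_rpow_const.tendsto _).comp
          ((continuous_enorm.tendsto _).comp (h1.sub h2))).liminf_eq).symm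
    _ ≤ liminf (fun n => ∫⁻ x in V, ‖mollify n F x - mollify n F (x - z)‖ₑ ^ p) atTop := by
        refine lintegral_liminf_le' fun n => ?_
        have : Continuous fun x => mollify n F x - mollify n F (x - z) := by
          have := (hsm n).continuous
          fun_prop
        exact (this.enorm.measurable.pow_const p).aemeasurable
    _ ≤ _ := by
        refine (liminf_le_liminf hsmooth).trans ?_
        simp

/-- An inequality of Faber–Krahn type: the `L^p` norm of a function vanishing outside a small set is
small compared with the `L^p` norms of the function and of its gradient on a larger set. The
function is compared with its averages over balls of radius `r`. -/
lemma IsWeakGrad.lintegral_rpow_le_of_support (h : IsWeakGrad U f g) (hU : IsOpen U)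
    (hfm : Measurable f) (hf : IntegrableOn f U) (hg : IntegrableOn g U) (hV : MeasurableSet V)
    {r : ℝ} (hr : 0 < r) (hVU : ∀ x ∈ V, Metric.closedBall x (2 * r) ⊆ U) {p : ℝ} (hp : 1 < p)
    {m : ℝ≥0∞} (hm : volume (U ∩ {x | f x ≠ 0}) ≤ m) :
    ∫⁻ x in V, ‖f x‖ₑ ^ p ≤ 2 ^ (p - 1) * (ENNReal.ofReal r ^ p * (∫⁻ x in U, ‖g x‖ₑ ^ p)
      + (m / volume (Metric.ball (0 : Eucl N) r)) ^ p * ∫⁻ x in U, ‖f x‖ₑ ^ p) := by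
  have hp0 : 0 < p := by linarith
  set B := Metric.ball (0 : Eucl N) r with hB
  have hB0 : volume B ≠ 0 := (Metric.measure_ball_pos volume _ hr).ne'
  have hBt : volume B ≠ ∞ := measure_ball_lt_top.ne
  set P : Measure (Eucl N) := (volume B)⁻¹ • volume.restrict B with hP
  have hprob : IsProbabilityMeasure P := ⟨by simp [hP, ENNReal.inv_mul_cancel hB0 hBt]⟩
  have hsubU : ∀ x ∈ V, ∀ z ∈ B, x - z ∈ U := fun x hx z hz => hVU x hx (by
    rw [Metric.mem_closedBall, dist_eq_norm, sub_sub_cancel_left, norm_neg]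
    rw [hB, mem_ball_zero_iff] at hz
    linarith)
  have hVsub : V ⊆ U := fun x hx => hVU x hx (Metric.mem_closedBall_self (by positivity))
  set T := {x | f x ≠ 0} with hT
  have hTm : MeasurableSet T := hfm (measurableSet_singleton 0).compl
  set A := ∫⁻ x in U, ‖f x‖ₑ with hA
  set I := ∫⁻ x in U, ‖f x‖ₑ ^ p with hI
  -- Hölder's inequality on the support of `f`
  have hHolder : A ^ p ≤ m ^ (p - 1) * I := by
    have hq : p.HolderConjugate (Real.conjExponent p) := Real.HolderConjugate.conjExponent hp
    have h1 := ENNReal.lintegral_mul_le_Lp_mul_Lq (volume.restrict U) hq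
      (f := fun x => ‖f x‖ₑ) (g := T.indicator 1) hfm.enorm.aemeasurable
      ((measurable_one.indicator hTm).aemeasurable)
    have h2 : ∫⁻ x in U, ((fun x => ‖f x‖ₑ) * T.indicator (1 : Eucl N → ℝ≥0∞)) x = A := by
      refine lintegral_congr fun x => ?_
      by_cases hx : x ∈ T
      · simp [hx]
      · have : f x = 0 := by simpa [hT] using hx
        simp [this]
    have h3 : ∫⁻ x in U, (T.indicator (1 : Eucl N → ℝ≥0∞) x) ^ (Real.conjExponent p)
        = volume (U ∩ T) := by
      have : ∀ x, (T.indicator (1 : Eucl N → ℝ≥0∞) x) ^ (Real.conjExponent p)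
          = T.indicator 1 x := fun x => by
        by_cases hx : x ∈ T <;> simp [hx, hq.symm.pos]
      simp_rw [this]
      rw [lintegral_indicator_one hTm, Measure.restrict_apply hTm, inter_comm]
    rw [h2, h3] at h1
    calc A ^ p ≤ (I ^ (1 / p) * m ^ (1 / Real.conjExponent p)) ^ p := by
          gcongr
          refine h1.trans ?_
          have : 0 ≤ 1 / Real.conjExponent p := one_div_nonneg.2 hq.symm.nonneg
          gcongr
      _ = m ^ (p - 1) * I := by
          rw [ENNReal.mul_rpow_of_nonneg _ _ hp0.le, ← ENNReal.rpow_mul, ← ENNReal.rpow_mul,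
            one_div_mul_cancel hp0.ne', ENNReal.rpow_one, mul_comm]
          congr 2
          rw [Real.conjExponent]
          field_simp
  have hjm : Measurable fun q : Eucl N × Eucl N => ‖f q.1 - f (q.1 - q.2)‖ₑ ^ p :=
    ((hfm.comp measurable_fst).sub
      (hfm.comp (measurable_fst.sub measurable_snd))).enorm.pow_const p
  have hpt : ∀ x ∈ V, ‖f x‖ₑ ^ p ≤ 2 ^ (p - 1) * (∫⁻ z, ‖f x - f (x - z)‖ₑ ^ p ∂P
      + T.indicator (fun _ => ((volume B)⁻¹ * A) ^ p) x) := by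
    intro x hx
    by_cases hxT : x ∈ T
    · have hm1 : Measurable fun z => ‖f x - f (x - z)‖ₑ :=
        (measurable_const.sub (hfm.comp (measurable_const.sub measurable_id))).enorm
      have h1 : ‖f x‖ₑ ≤ ∫⁻ z, ‖f x - f (x - z)‖ₑ ∂P + ∫⁻ z, ‖f (x - z)‖ₑ ∂P := by
        rw [← lintegral_add_left hm1]
        calc ‖f x‖ₑ = ∫⁻ z, ‖f x‖ₑ ∂P := by simp
          _ ≤ _ := by
            refine lintegral_mono fun z => ?_
            calc ‖f x‖ₑ = ‖(f x - f (x - z)) + f (x - z)‖ₑ := by rw [sub_add_cancel]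
              _ ≤ _ := enorm_add_le _ _
      have h2 : ∫⁻ z, ‖f (x - z)‖ₑ ∂P ≤ (volume B)⁻¹ * A := by
        rw [hP, lintegral_smul_measure, smul_eq_mul]
        gcongr
        rw [hA, ← lintegral_indicator hU.measurableSet, ← lintegral_indicator
          Metric.isOpen_ball.measurableSet]
        calc ∫⁻ z, B.indicator (fun z => ‖f (x - z)‖ₑ) z
            ≤ ∫⁻ z, U.indicator (fun x => ‖f x‖ₑ) (x - z) := by
              refine lintegral_mono fun z => ?_
              by_cases hz : z ∈ B
              · simp [hz, hsubU x hx z hz]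
              · simp [hz]
          _ = _ := lintegral_sub_left_eq_self (fun w => U.indicator (fun x => ‖f x‖ₑ) w) x
      rw [indicator_of_mem hxT]
      calc ‖f x‖ₑ ^ p ≤ (∫⁻ z, ‖f x - f (x - z)‖ₑ ∂P + (volume B)⁻¹ * A) ^ p := by
            gcongr
            exact h1.trans (by gcongr)
        _ ≤ 2 ^ (p - 1) * ((∫⁻ z, ‖f x - f (x - z)‖ₑ ∂P) ^ p + ((volume B)⁻¹ * A) ^ p) :=
            ENNReal.rpow_add_le_mul_rpow_add_rpow _ _ hp.le
        _ ≤ _ := by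
            gcongr
            exact rpow_lintegral_le_lintegral_rpow hm1.aemeasurable hp.le
    · have : f x = 0 := by simpa [hT] using hxT
      simp [this, hp0]
  have hfirst : ∫⁻ x in V, ∫⁻ z, ‖f x - f (x - z)‖ₑ ^ p ∂P
      ≤ ENNReal.ofReal r ^ p * ∫⁻ x in U, ‖g x‖ₑ ^ p := by
    rw [lintegral_lintegral_swap hjm.aemeasurable]
    have hle : ∀ z ∈ B, ∫⁻ x in V, ‖f x - f (x - z)‖ₑ ^ p
        ≤ ENNReal.ofReal r ^ p * ∫⁻ x in U, ‖g x‖ₑ ^ p := by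
      intro z hz
      rw [hB, mem_ball_zero_iff] at hz
      refine (h.lintegral_sub_translate_le hU hf hg hV (z := z) hr (fun x hx => ?_) hp.le).trans ?_
      · exact (Metric.closedBall_subset_closedBall (by linarith)).trans (hVU x hx)
      · gcongr
        rw [← ofReal_norm]
        exact ENNReal.ofReal_le_ofReal hz.le
    rw [hP, lintegral_smul_measure, smul_eq_mul]
    calc (volume B)⁻¹ * ∫⁻ z in B, ∫⁻ x in V, ‖f x - f (x - z)‖ₑ ^ p
        ≤ (volume B)⁻¹ * ∫⁻ _ in B, ENNReal.ofReal r ^ p * ∫⁻ x in U, ‖g x‖ₑ ^ p := by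
          exact mul_le_mul_right (setLIntegral_mono' Metric.isOpen_ball.measurableSet hle) _
      _ = _ := by
          rw [setLIntegral_const, mul_comm _ (volume B), ← mul_assoc,
            ENNReal.inv_mul_cancel hB0 hBt, one_mul]
  have hsecond : ∫⁻ x in V, T.indicator (fun _ => ((volume B)⁻¹ * A) ^ p) x
      ≤ (m / volume B) ^ p * I := by
    rw [lintegral_indicator_const hTm, Measure.restrict_apply hTm]
    calc ((volume B)⁻¹ * A) ^ p * volume (T ∩ V)
        ≤ ((volume B)⁻¹) ^ p * (m ^ (p - 1) * I) * m := by
          rw [ENNReal.mul_rpow_of_nonneg _ _ hp0.le]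
          gcongr
          refine (measure_mono ?_).trans hm
          exact fun x hx => ⟨hVsub hx.2, hx.1⟩
      _ = ((volume B)⁻¹) ^ p * (m ^ (p - 1) * m ^ (1 : ℝ)) * I := by
          rw [ENNReal.rpow_one]; ring
      _ = (m / volume B) ^ p * I := by
          rw [← ENNReal.rpow_add_of_nonneg _ _ (by linarith) zero_le_one, sub_add_cancel,
            ENNReal.div_eq_inv_mul, ENNReal.mul_rpow_of_nonneg _ _ hp0.le]
  calc ∫⁻ x in V, ‖f x‖ₑ ^ p
      ≤ ∫⁻ x in V, 2 ^ (p - 1) * (∫⁻ z, ‖f x - f (x - z)‖ₑ ^ p ∂P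
          + T.indicator (fun _ => ((volume B)⁻¹ * A) ^ p) x) := setLIntegral_mono' hV hpt
    _ = 2 ^ (p - 1) * ((∫⁻ x in V, ∫⁻ z, ‖f x - f (x - z)‖ₑ ^ p ∂P)
          + ∫⁻ x in V, T.indicator (fun _ => ((volume B)⁻¹ * A) ^ p) x) := by
        rw [lintegral_const_mul' _ _ (by finiteness), lintegral_add_left]
        exact hjm.lintegral_prod_right'
    _ ≤ _ := by gcongr

end

/-! ### Cubes and cylinders -/

section

variable {N : ℕ}

lemma isOpen_cube (y : Eucl N) (ρ : ℝ) : IsOpen (cube y ρ) := by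
  have : cube y ρ = ⋂ i, {x : Eucl N | |x i - y i| < ρ} := by ext; simp [cube]
  rw [this]
  refine isOpen_iInter_of_finite fun i => isOpen_lt ?_ continuous_const
  have : Continuous fun x : Eucl N => x i := (EuclideanSpace.proj (𝕜 := ℝ) i).continuous
  fun_prop

lemma cube_mono (y : Eucl N) {ρ R : ℝ} (h : ρ ≤ R) : cube y ρ ⊆ cube y R :=
  fun _ hx i => (hx i).trans_le h

/-- The closed cube of edge `2ρ` centred at `y`. -/
def closedCube (y : Eucl N) (ρ : ℝ) : Set (Eucl N) := {x | ∀ i, |x i - y i| ≤ ρ}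

lemma cube_subset_closedCube (y : Eucl N) (ρ : ℝ) : cube y ρ ⊆ closedCube y ρ :=
  fun _ hx i => (hx i).le

lemma isCompact_closedCube (y : Eucl N) (ρ : ℝ) : IsCompact (closedCube y ρ) := by
  have h : closedCube y ρ = (EuclideanSpace.equiv (Fin N) ℝ).toHomeomorph ⁻¹'
      (Set.pi univ fun i => Icc (y i - ρ) (y i + ρ)) := by
    ext x
    simp only [closedCube, mem_ofPred_eq, mem_preimage, mem_univ_pi, mem_Icc]
    refine forall_congr' fun i => ?_
    rw [abs_le]
    constructor
    · intro h; exact ⟨by change y i - ρ ≤ x i; linarith, by change x i ≤ y i + ρ; linarith⟩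
    · rintro ⟨h1, h2⟩
      change y i - ρ ≤ x i at h1
      change x i ≤ y i + ρ at h2
      exact ⟨by linarith, by linarith⟩
  rw [h, Homeomorph.isCompact_preimage]
  exact isCompact_univ_pi fun i => isCompact_Icc

lemma volume_cube_lt_top (y : Eucl N) (ρ : ℝ) : volume (cube y ρ) < ∞ :=
  (measure_mono (cube_subset_closedCube y ρ)).trans_lt (isCompact_closedCube y ρ).measure_lt_top

lemma closedBall_subset_cube {y x : Eucl N} {ρ r R : ℝ} (hx : x ∈ cube y ρ) (h : ρ + r ≤ R) :
    Metric.closedBall x r ⊆ cube y R := by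
  intro w hw i
  have h1 : |w i - x i| ≤ r := by
    have := PiLp.norm_apply_le (w - x) i
    rw [Metric.mem_closedBall, dist_eq_norm] at hw
    simpa using this.trans hw
  calc |w i - y i| = |(w i - x i) + (x i - y i)| := by ring_nf
    _ ≤ |w i - x i| + |x i - y i| := abs_add_le _ _
    _ < R := by have := hx i; linarith

lemma cyl_mono (y : Eucl N) (s : ℝ) {ρ R τ T : ℝ} (h : ρ ≤ R) (h' : τ ≤ T) :
    cyl y s ρ τ ⊆ cyl y s R T :=
  prod_mono (cube_mono y h) (Ioc_subset_Ioc_left (by linarith))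

lemma restrict_cyl (y : Eucl N) (s ρ τ : ℝ) :
    (volume : Measure (SpaceTime N)).restrict (cyl y s ρ τ)
      = (volume.restrict (cube y ρ)).prod (volume.restrict (Ioc (s - τ) s)) :=
  (Measure.prod_restrict _ _).symm

instance isFiniteMeasure_restrict_cube (y : Eucl N) (ρ : ℝ) :
    IsFiniteMeasure (volume.restrict (cube y ρ)) :=
  ⟨by simpa using volume_cube_lt_top y ρ⟩

instance isFiniteMeasure_restrict_cyl (y : Eucl N) (s ρ τ : ℝ) :
    IsFiniteMeasure ((volume : Measure (SpaceTime N)).restrict (cyl y s ρ τ)) := by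
  rw [restrict_cyl]; infer_instance

lemma ae_slice {y : Eucl N} {s ρ τ : ℝ} {P : SpaceTime N → Prop}
    (h : ∀ᵐ z ∂(volume.restrict (cyl y s ρ τ)), P z) :
    ∀ᵐ t ∂(volume.restrict (Ioc (s - τ) s)), ∀ᵐ x ∂(volume.restrict (cube y ρ)), P (x, t) := by
  rw [restrict_cyl] at h
  exact Measure.ae_ae_of_ae_prod ((Measure.measurePreserving_swap
    (μ := volume.restrict (Ioc (s - τ) s))
    (ν := volume.restrict (cube y ρ))).quasiMeasurePreserving.ae h)

/-! ### Spatial gradients on cylinders -/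

variable {p : ℝ} {v : SpaceTime N → ℝ} {G G' : SpaceTime N → Eucl N} {y : Eucl N} {s R T : ℝ}

lemma HasSpatialGradient.weak_slice (h : HasSpatialGradient p v G y s R T) :
    ∀ᵐ t ∂(volume.restrict (Ioc (s - T) s)),
      IsWeakGrad (cube y R) (fun x => v (x, t)) (fun x => G (x, t)) :=
  h.weak

lemma HasSpatialGradient.integrable_slice (h : HasSpatialGradient p v G y s R T) (hp : 1 ≤ p) :
    ∀ᵐ t ∂(volume.restrict (Ioc (s - T) s)),
      IntegrableOn (fun x => v (x, t)) (cube y R) ∧ IntegrableOn (fun x => G (x, t)) (cube y R) := by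
  have h1 := h.memLp.integrable (by simpa using hp)
  have h2 := h.grad_memLp.integrable (by simpa using hp)
  rw [restrict_cyl] at h1 h2
  filter_upwards [h1.prod_left_ae, h2.prod_left_ae] with t h1 h2
  exact ⟨h1, h2⟩

lemma HasSpatialGradient.congr {v' : SpaceTime N → ℝ} (h : HasSpatialGradient p v G y s R T)
    (hv : v =ᵐ[volume.restrict (cyl y s R T)] v')
    (hG : G =ᵐ[volume.restrict (cyl y s R T)] G') : HasSpatialGradient p v' G' y s R T where
  memLp := h.memLp.ae_eq hv
  grad_memLp := h.grad_memLp.ae_eq hG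
  weak := by
    filter_upwards [h.weak_slice, ae_slice hv, ae_slice hG] with t h1 h2 h3
    exact h1.congr h2 h3

lemma HasSpatialGradient.mono {R' T' : ℝ} (h : HasSpatialGradient p v G y s R T) (hR : R' ≤ R)
    (hT : T' ≤ T) : HasSpatialGradient p v G y s R' T' where
  memLp := h.memLp.mono_measure (Measure.restrict_mono (cyl_mono y s hR hT) le_rfl)
  grad_memLp := h.grad_memLp.mono_measure (Measure.restrict_mono (cyl_mono y s hR hT) le_rfl)
  weak := by
    have : ∀ᵐ t ∂(volume.restrict (Ioc (s - T') s)),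
        IsWeakGrad (cube y R) (fun x => v (x, t)) (fun x => G (x, t)) :=
      ae_mono (Measure.restrict_mono (Ioc_subset_Ioc_left (by linarith)) le_rfl) h.weak_slice
    filter_upwards [this] with t ht
    exact ht.mono (isOpen_cube y R).measurableSet (cube_mono y hR)

lemma HasSpatialGradient.unique (h : HasSpatialGradient p v G y s R T)
    (h' : HasSpatialGradient p v G' y s R T) (hp : 1 ≤ p) :
    G =ᵐ[volume.restrict (cyl y s R T)] G' := by
  have hm : AEStronglyMeasurable (fun z => G z - G' z) (volume.restrict (cyl y s R T)) :=
    h.grad_memLp.1.sub h'.grad_memLp.1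
  have h0 : ∫⁻ z in cyl y s R T, ‖G z - G' z‖ₑ = 0 := by
    have hm' := hm.enorm
    rw [restrict_cyl] at hm' ⊢
    rw [lintegral_prod_symm _ hm', lintegral_eq_zero_iff' hm'.lintegral_prod_left']
    filter_upwards [h.weak_slice, h'.weak_slice, h.integrable_slice hp, h'.integrable_slice hp]
      with t h1 h2 h3 h4
    have := h1.unique h2 (isOpen_cube y R) h3.2 h4.2
    rw [Pi.zero_apply, ← lintegral_zero (μ := volume.restrict (cube y R))]
    refine lintegral_congr_ae ?_
    filter_upwards [this] with x hx
    simp [hx]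
  rw [lintegral_eq_zero_iff' hm.enorm] at h0
  filter_upwards [h0] with z hz
  simpa [sub_eq_zero] using hz

/-- A right derivative that exists everywhere is Borel measurable. -/
lemma measurable_of_hasDerivWithinAt_Ioi {β d : ℝ → ℝ}
    (hd : ∀ r, HasDerivWithinAt β (d r) (Ioi r) r) : Measurable d := by
  have : d = fun r => derivWithin β (Ioi r) r := by
    funext r
    exact ((hd r).derivWithin (uniqueDiffWithinAt_Ioi r)).symm
  rw [this]
  exact measurable_derivWithin_Ioi β

lemma norm_le_of_lipschitzWith_of_hasDerivWithinAt {β d : ℝ → ℝ} {L : ℝ≥0}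
    (hβ : LipschitzWith L β) (hd : ∀ r, HasDerivWithinAt β (d r) (Ioi r) r) (r : ℝ) :
    ‖d r‖ ≤ L := by
  have h1 := hasDerivWithinAt_iff_tendsto_slope.1 (hd r)
  have hne : (𝓝[Ioi r \ {r}] r).NeBot := by
    rw [sdiff_singleton_eq_self (by simp)]; infer_instance
  refine le_of_tendsto h1.norm (eventually_nhdsWithin_of_forall fun x hx => ?_)
  have h2 := hβ.norm_sub_le x r
  rw [slope_def_field, norm_div]
  exact div_le_of_le_mul₀ (norm_nonneg _) L.2 h2

/-- Chain rule on cylinders for Lipschitz functions with a right derivative at every point. -/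
lemma HasSpatialGradient.comp_lipschitz (h : HasSpatialGradient p v G y s R T) (hp : 1 ≤ p)
    {β d : ℝ → ℝ} {L : ℝ≥0} (hβ : LipschitzWith L β)
    (hd : ∀ r, HasDerivWithinAt β (d r) (Ioi r) r) :
    HasSpatialGradient p (fun z => β (v z)) (fun z => d (v z) • G z) y s R T where
  memLp := by
    have h1 : MemLp (fun z => β (v z) - β 0) (ENNReal.ofReal p)
        (volume.restrict (cyl y s R T)) := by
      refine h.memLp.of_le_mul (c := L)
        ((hβ.continuous.comp_aestronglyMeasurable h.memLp.1).sub aestronglyMeasurable_const)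
        (ae_of_all _ fun z => ?_)
      simpa using hβ.norm_sub_le (v z) 0
    have h2 := h1.add (memLp_const (β 0))
    refine h2.ae_eq (ae_of_all _ fun z => ?_)
    simp
  grad_memLp := by
    refine h.grad_memLp.of_le_mul (c := L) ?_ (ae_of_all _ fun z => ?_)
    · exact ((measurable_of_hasDerivWithinAt_Ioi hd).comp_aemeasurable
        h.memLp.1.aemeasurable).aestronglyMeasurable.smul h.grad_memLp.1
    · rw [norm_smul]
      gcongr
      exact norm_le_of_lipschitzWith_of_hasDerivWithinAt hβ hd _
  weak := by
    filter_upwards [h.weak_slice, h.integrable_slice hp] with t h1 h2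
    exact h1.comp_lipschitz (isOpen_cube y R) h2.1 h2.2 hβ hd

/-! ### Energy estimates below the levels -/

lemma lipschitzWith_negPart_sub (k : ℝ) : LipschitzWith 1 fun r : ℝ => (r - k)⁻ := by
  refine LipschitzWith.of_le_add fun a b => ?_
  rw [Real.dist_eq, negPart_def, negPart_def]
  have h1 := le_abs_self (b - a)
  have h2 := abs_sub_comm a b
  refine sup_le ?_ ?_
  · have := le_sup_left (a := -(b - k)) (b := (0 : ℝ))
    linarith
  · have := le_sup_right (a := -(b - k)) (b := (0 : ℝ))
    have := abs_nonneg (a - b)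
    linarith

lemma hasDerivWithinAt_negPart_sub (k r : ℝ) :
    HasDerivWithinAt (fun r : ℝ => (r - k)⁻) (if r < k then -1 else 0) (Ioi r) r := by
  split_ifs with h
  · have h1 : HasDerivAt (fun r : ℝ => k - r) (-1) r := by
      simpa using (hasDerivAt_id r).const_sub k
    refine (h1.congr_of_eventuallyEq ?_).hasDerivWithinAt
    filter_upwards [gt_mem_nhds h] with x hx
    rw [negPart_def, neg_sub]
    exact sup_of_le_left (by linarith)
  · refine (hasDerivWithinAt_const r (Ioi r) (0 : ℝ)).congr (fun x hx => ?_) ?_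
    · exact negPart_eq_zero.2 (by have := mem_Ioi.1 hx; linarith)
    · exact negPart_eq_zero.2 (by linarith)

lemma ofReal_negPart_sub (r k : ℝ) : ENNReal.ofReal (r - k)⁻ = ENNReal.ofReal (k - r) := by
  rw [negPart_def, neg_sub]
  rcases le_total (k - r) 0 with h | h
  · rw [sup_of_le_right h, ENNReal.ofReal_of_nonpos h, ENNReal.ofReal_zero]
  · rw [sup_of_le_left h]

/-- The energy estimates of the class `𝔄_p^-` on a cylinder, for a Borel function `v` with a Borel
spatial gradient `D`. All truncations `(v - k)_-` share the single gradient `D` on `{v < k}`, and the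
estimates hold on all smaller cylinders with the same vertex `(y, s)`. -/
structure LevelEstimates (p γ : ℝ) (v : SpaceTime N → ℝ) (D : SpaceTime N → Eucl N)
    (y : Eucl N) (s R₀ T₀ : ℝ) : Prop where
  measurable : Measurable v
  measurable_grad : Measurable D
  hasSpatialGradient : HasSpatialGradient p v D y s R₀ T₀
  slice : ∀ R T ρ τ k : ℝ, 0 < ρ → ρ < R → R ≤ R₀ → 0 < τ → τ < T → T ≤ T₀ →
    ∀ᵐ t ∂(volume.restrict (Ioc (s - τ) s)),
      ∫⁻ x in cube y ρ, ENNReal.ofReal (k - v (x, t)) ^ p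
        ≤ ENNReal.ofReal (γ / (R - ρ) ^ p + γ / (T - τ)) *
          ∫⁻ z in cyl y s R T, ENNReal.ofReal (k - v z) ^ p
  grad : ∀ R T ρ τ k : ℝ, 0 < ρ → ρ < R → R ≤ R₀ → 0 < τ → τ < T → T ≤ T₀ →
    ∫⁻ z in cyl y s ρ τ, {z | v z < k}.indicator (fun z => ‖D z‖ₑ ^ p) z
      ≤ ENNReal.ofReal (γ / (R - ρ) ^ p + γ / (T - τ)) *
          ∫⁻ z in cyl y s R T, ENNReal.ofReal (k - v z) ^ p

/-- A member of `𝔄_p^-` satisfies the level estimates on every cylinder compactly contained in the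
domain: by the chain rule and the uniqueness of weak gradients, the gradient of `(u - k)_-` in its
energy inequality is `-Du` on `{u < k}` and `0` elsewhere. -/
lemma ClassAMinus.exists_levelEstimates {γ : ℝ} {E : Set (SpaceTime N)} {u : SpaceTime N → ℝ}
    (hu : ClassAMinus p γ E u) (hp : 1 < p) (hR : 0 < R) (hT : 0 < T)
    (hE : closure (cyl y s R T) ⊆ E) :
    ∃ v D, u =ᵐ[volume.restrict (cyl y s R T)] v ∧ LevelEstimates p γ v D y s R T := by
  obtain ⟨-, G₀, hG₀⟩ := hu.energySpace y s R T hR hT hE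
  have hp0 : 0 < p := by linarith
  set v := hG₀.memLp.1.mk u with hv
  set D := hG₀.grad_memLp.1.mk G₀ with hD
  have huv : u =ᵐ[volume.restrict (cyl y s R T)] v := hG₀.memLp.1.ae_eq_mk
  have hGD : G₀ =ᵐ[volume.restrict (cyl y s R T)] D := hG₀.grad_memLp.1.ae_eq_mk
  have hgrad : HasSpatialGradient p v D y s R T := hG₀.congr huv hGD
  have hint : ∀ {R' T' : ℝ}, R' ≤ R → T' ≤ T → ∀ k : ℝ,
      ∫⁻ z in cyl y s R' T', ENNReal.ofReal (u z - k)⁻ ^ p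
        = ∫⁻ z in cyl y s R' T', ENNReal.ofReal (k - v z) ^ p := by
    intro R' T' hR' hT' k
    refine lintegral_congr_ae ?_
    filter_upwards [ae_mono (Measure.restrict_mono (cyl_mono y s hR' hT') le_rfl) huv] with z hz
    rw [ofReal_negPart_sub, hz]
  refine ⟨v, D, huv, hG₀.memLp.1.stronglyMeasurable_mk.measurable,
    hG₀.grad_memLp.1.stronglyMeasurable_mk.measurable, hgrad, ?_, ?_⟩
  · intro R' T' ρ τ k hρ hρR hR' hτ hτT hT'
    have hE' : closure (cyl y s R' T') ⊆ E := (closure_mono (cyl_mono y s hR' hT')).trans hE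
    obtain ⟨Gk, hGk, hen⟩ := hu.energy y s R' T' (hρ.trans hρR) (hτ.trans hτT) hE' k
    have h1 := hen ρ τ hρ hρR hτ hτT
    rw [EnergyInequality, hint hR' hT' k] at h1
    have h2 := ENNReal.ae_le_essSup (μ := volume.restrict (Ioo (s - τ) s))
      fun t => ∫⁻ x in cube y ρ, ENNReal.ofReal (u (x, t) - k)⁻ ^ p
    rw [Measure.restrict_congr_set Ioo_ae_eq_Ioc] at h1 h2
    have h3 := ae_slice (ae_mono
      (Measure.restrict_mono (cyl_mono y s (hρR.le.trans hR') (hτT.le.trans hT')) le_rfl) huv)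
    filter_upwards [h2, h3] with t h2 h3
    have h4 : ∫⁻ x in cube y ρ, ENNReal.ofReal (k - v (x, t)) ^ p
        = ∫⁻ x in cube y ρ, ENNReal.ofReal (u (x, t) - k)⁻ ^ p := by
      refine lintegral_congr_ae ?_
      filter_upwards [h3] with x hx
      rw [ofReal_negPart_sub, hx]
    rw [h4]
    exact h2.trans (le_self_add.trans h1)
  · intro R' T' ρ τ k hρ hρR hR' hτ hτT hT'
    have hE' : closure (cyl y s R' T') ⊆ E := (closure_mono (cyl_mono y s hR' hT')).trans hE
    obtain ⟨Gk, hGk, hen⟩ := hu.energy y s R' T' (hρ.trans hρR) (hτ.trans hτT) hE' k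
    have h1 := hen ρ τ hρ hρR hτ hτT
    rw [EnergyInequality, hint hR' hT' k] at h1
    have h2 := ((hgrad.mono hR' hT').comp_lipschitz hp.le (lipschitzWith_negPart_sub k)
      (hasDerivWithinAt_negPart_sub k))
    have huv' : u =ᵐ[volume.restrict (cyl y s R' T')] v :=
      ae_mono (Measure.restrict_mono (cyl_mono y s hR' hT') le_rfl) huv
    have h3 : HasSpatialGradient p (fun z => (v z - k)⁻) Gk y s R' T' := by
      refine hGk.congr ?_ (ae_eq_refl _)
      filter_upwards [huv'] with z hz
      simp only [hz]
    have h4 := ae_mono (Measure.restrict_mono (cyl_mono y s hρR.le hτT.le) le_rfl)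
      (h3.unique h2 hp.le)
    have h5 : ∫⁻ z in cyl y s ρ τ, {z | v z < k}.indicator (fun z => ‖D z‖ₑ ^ p) z
        = ∫⁻ z in cyl y s ρ τ, ‖Gk z‖ₑ ^ p := by
      refine lintegral_congr_ae ?_
      filter_upwards [h4] with z hz
      rw [hz]
      by_cases hk : v z < k <;> simp [hk, hp0]
    rw [h5]
    exact le_add_self.trans h1

end

/-! ### De Giorgi iteration and the local lower bound -/

section

variable {N : ℕ} {p γ : ℝ} {v : SpaceTime N → ℝ} {D : SpaceTime N → Eucl N} {y : Eucl N}
  {s R₀ T₀ : ℝ}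

/-- One step of the De Giorgi iteration: if the excess below the level `k₁` is at most `Y` on a
cylinder, then the excess below a lower level `k₂` on a smaller cylinder is controlled, with a gain
coming from the smallness of `{v < k₂}` on almost every time slice. -/
lemma LevelEstimates.deGiorgi_step (h : LevelEstimates p γ v D y s R₀ T₀) (hp : 1 < p) (hγ : 0 < γ)
    {R₁ ρ R₂ T₁ T₂ k₁ k₂ r Y Γ : ℝ} (hR₂ : 0 < R₂) (hr : 0 < r) (hρ : R₂ + 2 * r ≤ ρ) (hρR : ρ < R₁)
    (hR₁ : R₁ ≤ R₀) (hT₂ : 0 < T₂) (hT : T₂ < T₁) (hT₁ : T₁ ≤ T₀) (hk : k₂ < k₁) (hY : 0 ≤ Y)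
    (hΓ : γ / (R₁ - ρ) ^ p + γ / (T₁ - T₂) ≤ Γ)
    (hY₁ : ∫⁻ z in cyl y s R₁ T₁, ENNReal.ofReal (k₁ - v z) ^ p ≤ ENNReal.ofReal Y) :
    ∫⁻ z in cyl y s R₂ T₂, ENNReal.ofReal (k₂ - v z) ^ p ≤
      ENNReal.ofReal (2 ^ (p - 1) * (r ^ p * Γ + (Γ * Y / (k₁ - k₂) ^ p /
        (r ^ N * (volume (Metric.ball (0 : Eucl N) 1)).toReal)) ^ p) * Y) := by
  have hp0 : 0 < p := by linarith
  have hρ0 : 0 < ρ := by linarith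
  have hkk : 0 < k₁ - k₂ := by linarith
  set ω := (volume (Metric.ball (0 : Eucl N) 1)).toReal with hω
  have hω0 : 0 < ω := ENNReal.toReal_pos (Metric.measure_ball_pos volume _ one_pos).ne'
    measure_ball_lt_top.ne
  have hΓ0 : 0 < Γ := by
    refine lt_of_lt_of_le ?_ hΓ
    have h1 : 0 < (R₁ - ρ) ^ p := Real.rpow_pos_of_pos (by linarith) _
    have h2 : 0 < T₁ - T₂ := by linarith
    positivity
  set Γ' := ENNReal.ofReal (γ / (R₁ - ρ) ^ p + γ / (T₁ - T₂)) with hΓ'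
  have hΓΓ : Γ' ≤ ENNReal.ofReal Γ := ENNReal.ofReal_le_ofReal hΓ
  set w : SpaceTime N → ℝ := fun z => (v z - k₂)⁻ with hw
  set d : ℝ → ℝ := fun r => if r < k₂ then -1 else 0 with hd
  have hwm : Measurable w := (lipschitzWith_negPart_sub k₂).continuous.measurable.comp h.measurable
  have hwe : ∀ z, ‖w z‖ₑ = ENNReal.ofReal (k₂ - v z) := fun z => by
    rw [← ofReal_negPart_sub, Real.enorm_of_nonneg (negPart_nonneg _)]
  have hgw : HasSpatialGradient p w (fun z => d (v z) • D z) y s ρ T₂ :=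
    (h.hasSpatialGradient.mono (hρR.le.trans hR₁) (hT.le.trans hT₁)).comp_lipschitz hp.le
      (lipschitzWith_negPart_sub k₂) (hasDerivWithinAt_negPart_sub k₂)
  have hdm : Measurable d := Measurable.ite measurableSet_Iio measurable_const measurable_const
  have hDm : Measurable fun z => ‖d (v z) • D z‖ₑ ^ p :=
    ((hdm.comp h.measurable).smul h.measurable_grad).enorm.pow_const p
  set m : ℝ≥0∞ := ENNReal.ofReal (Γ * Y / (k₁ - k₂) ^ p) with hm
  -- Chebyshev's inequality on almost every time slice
  have hsupp : ∀ᵐ t ∂(volume.restrict (Ioc (s - T₂) s)),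
      volume (cube y ρ ∩ {x | w (x, t) ≠ 0}) ≤ m := by
    filter_upwards [h.slice R₁ T₁ ρ T₂ k₁ hρ0 hρR hR₁ hT₂ hT hT₁] with t ht
    have hsub : cube y ρ ∩ {x | w (x, t) ≠ 0} ⊆ {x | ENNReal.ofReal (k₁ - k₂) ^ p
        ≤ ENNReal.ofReal (k₁ - v (x, t)) ^ p} ∩ cube y ρ := by
      rintro x ⟨hx, hx'⟩
      refine ⟨?_, hx⟩
      have : v (x, t) < k₂ := by
        by_contra hcon
        exact hx' (negPart_eq_zero.2 (by linarith))
      simp only [mem_ofPred_eq]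
      gcongr
    have hvt : Measurable fun x => ENNReal.ofReal (k₁ - v (x, t)) ^ p :=
      ((measurable_const.sub (h.measurable.comp measurable_prodMk_right)).ennreal_ofReal).pow_const p
    have hmark := mul_meas_ge_le_lintegral₀ (μ := volume.restrict (cube y ρ)) hvt.aemeasurable
      (ENNReal.ofReal (k₁ - k₂) ^ p)
    rw [Measure.restrict_apply (measurableSet_le measurable_const hvt)] at hmark
    have hpos : 0 < (k₁ - k₂) ^ p := Real.rpow_pos_of_pos hkk p
    rw [hm, ENNReal.ofReal_div_of_pos hpos, ENNReal.le_div_iff_mul_le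
      (Or.inl (ENNReal.ofReal_pos.2 hpos).ne') (Or.inl ENNReal.ofReal_ne_top), mul_comm,
      ← ENNReal.ofReal_rpow_of_pos hkk, ENNReal.ofReal_mul hΓ0.le]
    calc ENNReal.ofReal (k₁ - k₂) ^ p * volume (cube y ρ ∩ {x | w (x, t) ≠ 0})
        ≤ ENNReal.ofReal (k₁ - k₂) ^ p * volume ({x | ENNReal.ofReal (k₁ - k₂) ^ p
          ≤ ENNReal.ofReal (k₁ - v (x, t)) ^ p} ∩ cube y ρ) := by gcongr
      _ ≤ _ := hmark
      _ ≤ _ := ht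
      _ ≤ _ := by gcongr
  have hslice : ∀ᵐ t ∂(volume.restrict (Ioc (s - T₂) s)),
      ∫⁻ x in cube y R₂, ‖w (x, t)‖ₑ ^ p ≤ 2 ^ (p - 1) * (ENNReal.ofReal r ^ p *
        (∫⁻ x in cube y ρ, ‖d (v (x, t)) • D (x, t)‖ₑ ^ p)
        + (m / volume (Metric.ball (0 : Eucl N) r)) ^ p * ∫⁻ x in cube y ρ, ‖w (x, t)‖ₑ ^ p) := by
    filter_upwards [hsupp, hgw.weak_slice, hgw.integrable_slice hp.le] with t h1 h2 h3
    exact h2.lintegral_rpow_le_of_support (isOpen_cube y ρ) (hwm.comp measurable_prodMk_right)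
      h3.1 h3.2 (isOpen_cube y R₂).measurableSet hr (fun x hx => closedBall_subset_cube hx hρ) hp h1
  have hgrad : ∫⁻ z in cyl y s ρ T₂, ‖d (v z) • D z‖ₑ ^ p
      ≤ ENNReal.ofReal Γ * ENNReal.ofReal Y := by
    have h1 := h.grad R₁ T₁ ρ T₂ k₂ hρ0 hρR hR₁ hT₂ hT hT₁
    calc ∫⁻ z in cyl y s ρ T₂, ‖d (v z) • D z‖ₑ ^ p
        = ∫⁻ z in cyl y s ρ T₂, {z | v z < k₂}.indicator (fun z => ‖D z‖ₑ ^ p) z := by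
          refine lintegral_congr fun z => ?_
          by_cases hz : v z < k₂ <;> simp [hz, hd, hp0]
      _ ≤ _ := h1
      _ ≤ ENNReal.ofReal Γ * ENNReal.ofReal Y := by
          gcongr
          refine le_trans (lintegral_mono fun z => ?_) hY₁
          gcongr
  have hfun : ∫⁻ z in cyl y s ρ T₂, ‖w z‖ₑ ^ p ≤ ENNReal.ofReal Y := by
    refine (lintegral_mono_set (cyl_mono y s hρR.le hT.le)).trans
      (le_trans (lintegral_mono fun z => ?_) hY₁)
    simp only
    rw [hwe]
    gcongr
  have hB : volume (Metric.ball (0 : Eucl N) r) = ENNReal.ofReal (r ^ N * ω) := by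
    rw [Measure.addHaar_ball_of_pos _ _ hr, ENNReal.ofReal_mul (by positivity), hω,
      ENNReal.ofReal_toReal measure_ball_lt_top.ne]
    simp
  have hK0 : 0 ≤ Γ * Y / (k₁ - k₂) ^ p / (r ^ N * ω) := by positivity
  have hK : (m / volume (Metric.ball (0 : Eucl N) r)) ^ p
      = ENNReal.ofReal ((Γ * Y / (k₁ - k₂) ^ p / (r ^ N * ω)) ^ p) := by
    rw [hB, hm, ← ENNReal.ofReal_div_of_pos (by positivity),
      ENNReal.ofReal_rpow_of_nonneg hK0 hp0.le]
  have hK' : (m / volume (Metric.ball (0 : Eucl N) r)) ^ p ≠ ∞ := by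
    rw [hK]; exact ENNReal.ofReal_ne_top
  have hprod : ∀ {ρ : ℝ} {F : SpaceTime N → ℝ≥0∞}, Measurable F → ∫⁻ z in cyl y s ρ T₂, F z
      = ∫⁻ t in Ioc (s - T₂) s, ∫⁻ x in cube y ρ, F (x, t) := by
    intro ρ F hF
    rw [restrict_cyl, lintegral_prod_symm _ hF.aemeasurable]
  have hwp : Measurable fun z => ‖w z‖ₑ ^ p := hwm.enorm.pow_const p
  calc ∫⁻ z in cyl y s R₂ T₂, ENNReal.ofReal (k₂ - v z) ^ p
      = ∫⁻ t in Ioc (s - T₂) s, ∫⁻ x in cube y R₂, ‖w (x, t)‖ₑ ^ p := by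
        rw [← hprod hwp]
        simp_rw [hwe]
    _ ≤ ∫⁻ t in Ioc (s - T₂) s, 2 ^ (p - 1) * (ENNReal.ofReal r ^ p *
        (∫⁻ x in cube y ρ, ‖d (v (x, t)) • D (x, t)‖ₑ ^ p)
        + (m / volume (Metric.ball (0 : Eucl N) r)) ^ p * ∫⁻ x in cube y ρ, ‖w (x, t)‖ₑ ^ p) :=
        lintegral_mono_ae hslice
    _ = 2 ^ (p - 1) * (ENNReal.ofReal r ^ p * (∫⁻ z in cyl y s ρ T₂, ‖d (v z) • D z‖ₑ ^ p)
        + (m / volume (Metric.ball (0 : Eucl N) r)) ^ p * ∫⁻ z in cyl y s ρ T₂, ‖w z‖ₑ ^ p) := by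
        rw [lintegral_const_mul' _ _ (by finiteness), lintegral_add_left,
          lintegral_const_mul' _ _ (by finiteness), lintegral_const_mul' _ _ hK', hprod hDm,
          hprod hwp]
        exact (hDm.lintegral_prod_left').const_mul _
    _ ≤ 2 ^ (p - 1) * (ENNReal.ofReal r ^ p * (ENNReal.ofReal Γ * ENNReal.ofReal Y)
        + ENNReal.ofReal ((Γ * Y / (k₁ - k₂) ^ p / (r ^ N * ω)) ^ p) * ENNReal.ofReal Y) := by
        rw [hK]
        gcongr
    _ = _ := by
        have h2 : (2 : ℝ≥0∞) ^ (p - 1) = ENNReal.ofReal (2 ^ (p - 1)) := by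
          rw [← ENNReal.ofReal_rpow_of_pos two_pos]; simp
        have hKp := Real.rpow_nonneg hK0 p
        rw [h2, ENNReal.ofReal_rpow_of_pos hr, ← ENNReal.ofReal_mul hΓ0.le,
          ← ENNReal.ofReal_mul (by positivity), ← ENNReal.ofReal_mul hKp,
          ← ENNReal.ofReal_add (by positivity) (by positivity), ← ENNReal.ofReal_mul (by positivity)]
        congr 1
        ring

/-- De Giorgi's lemma: if the excess of `v` below `k` is small compared with `d ^ p` on a cylinder,
then `v ≥ k - d` on a smaller cylinder. -/
lemma LevelEstimates.ae_ge_of_small (h : LevelEstimates p γ v D y s R₀ T₀) (hp : 1 < p) (hγ : 0 < γ)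
    {R T : ℝ} (hR : 0 < R) (hRR : R < R₀) (hT : 0 < T) (hTT : T < T₀) :
    ∃ ν : ℝ, 0 < ν ∧ ∀ k d : ℝ, 0 < d →
      ∫⁻ z in cyl y s R₀ T₀, ENNReal.ofReal (k - v z) ^ p ≤ ENNReal.ofReal (ν * d ^ p) →
      ∀ᵐ z ∂(volume.restrict (cyl y s R T)), k - d ≤ v z := by
  have hp0 : 0 < p := by linarith
  set ω := (volume (Metric.ball (0 : Eucl N) 1)).toReal with hω
  have hω0 : 0 < ω := ENNReal.toReal_pos (Metric.measure_ball_pos volume _ one_pos).ne'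
    measure_ball_lt_top.ne
  set δ := R₀ - R with hδ
  set η := T₀ - T with hη
  have hδ0 : 0 < δ := by linarith
  have hη0 : 0 < η := by linarith
  set C := γ * (4 / δ) ^ p + 2 * γ / η with hC
  have hC0 : 0 < C := by positivity
  set b : ℝ := 2 ^ p with hb
  have hb0 : 0 < b := by positivity
  have hb2 : 2 ≤ b := by
    calc (2 : ℝ) = 2 ^ (1 : ℝ) := by simp
      _ ≤ b := Real.rpow_le_rpow_of_exponent_le (by norm_num) hp.le
  set q : ℝ := 1 / 2 with hq
  have hqb : q ^ p * b = 1 := by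
    rw [hq, hb, ← Real.mul_rpow (by norm_num) (by norm_num)]; norm_num
  -- the decay rate of the excess, chosen so that the powers of `2` cancel in the iteration
  set θ : ℝ := q ^ N / (b * b) with hθ
  have hθ0 : 0 < θ := by positivity
  have hθ1 : θ < 1 := by
    rw [hθ, div_lt_one (by positivity)]
    have h1 : q ^ N ≤ 1 := pow_le_one₀ (by norm_num [hq]) (by norm_num [hq])
    nlinarith
  have htend : Tendsto (fun c : ℝ => c ^ p) (𝓝[>] 0) (𝓝 0) := by
    have : Tendsto (fun c : ℝ => c ^ p) (𝓝 0) (𝓝 (0 ^ p)) :=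
      (Real.continuousAt_rpow_const 0 p (Or.inr hp0.le)).tendsto
    rw [Real.zero_rpow hp0.ne'] at this
    exact this.mono_left nhdsWithin_le_nhds
  obtain ⟨c, hc1, hc2, hc0⟩ : ∃ c : ℝ, 2 ^ (p - 1) * (c ^ p * C) < θ / 2 ∧ c < δ / 8 ∧ 0 < c := by
    have h1 : Tendsto (fun c : ℝ => 2 ^ (p - 1) * (c ^ p * C)) (𝓝[>] 0) (𝓝 0) := by
      simpa using (htend.mul_const C).const_mul (2 ^ (p - 1))
    have h2 : ∀ᶠ c : ℝ in 𝓝[>] 0, c < δ / 8 :=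
      nhdsWithin_le_nhds (gt_mem_nhds (by positivity))
    exact ((h1.eventually (gt_mem_nhds (by positivity))).and
      (h2.and self_mem_nhdsWithin)).exists
  obtain ⟨ν, hν1, hν0⟩ : ∃ ν : ℝ,
      2 ^ (p - 1) * (ν * (C * b / (c ^ N * ω))) ^ p < θ / 2 ∧ 0 < ν := by
    have h0 : Tendsto (fun ν : ℝ => ν * (C * b / (c ^ N * ω))) (𝓝[>] 0) (𝓝[>] 0) := by
      refine tendsto_nhdsWithin_iff.2 ⟨?_, ?_⟩
      · have : Tendsto (fun ν : ℝ => ν * (C * b / (c ^ N * ω))) (𝓝 0)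
            (𝓝 (0 * (C * b / (c ^ N * ω)))) := tendsto_id.mul_const _
        rw [zero_mul] at this
        exact this.mono_left nhdsWithin_le_nhds
      · filter_upwards [self_mem_nhdsWithin] with ν hν
        have : 0 < ν := hν
        exact mem_Ioi.2 (by positivity)
    have h1 : Tendsto (fun ν : ℝ => 2 ^ (p - 1) * (ν * (C * b / (c ^ N * ω))) ^ p) (𝓝[>] 0)
        (𝓝 0) := by
      simpa using (htend.comp h0).const_mul (2 ^ (p - 1))
    exact ((h1.eventually (gt_mem_nhds (by positivity))).and self_mem_nhdsWithin).exists
  refine ⟨ν, hν0, fun k d hd hsmall => ?_⟩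
  have hq0 : ∀ n : ℕ, 0 < q ^ n := fun n => by positivity
  have hq1 : ∀ n : ℕ, q ^ (n + 1) = q ^ n / 2 := fun n => by rw [pow_succ, hq]; ring
  have hqle : ∀ n : ℕ, q ^ n ≤ 1 := fun n => pow_le_one₀ (by norm_num [hq]) (by norm_num [hq])
  have hqp : ∀ n : ℕ, (q ^ n) ^ p = (b ^ n)⁻¹ := fun n => by
    rw [← Real.rpow_natCast, ← Real.rpow_mul (by positivity), mul_comm, Real.rpow_mul (by positivity),
      Real.rpow_natCast, ← inv_pow]
    congr 1
    exact eq_inv_of_mul_eq_one_left hqb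
  have hiter : ∀ n : ℕ,
      ∫⁻ z in cyl y s (R + δ * q ^ n) (T + η * q ^ n), ENNReal.ofReal (k - d * (1 - q ^ n) - v z) ^ p
        ≤ ENNReal.ofReal (θ ^ n * (ν * d ^ p)) := by
    intro n
    induction n with
    | zero => simpa [hδ, hη] using hsmall
    | succ n ih =>
      have hqn := hq0 n
      have hqn1 := hqle n
      have hδq : 0 < δ * q ^ n := by positivity
      have hηq : 0 < η * q ^ n := by positivity
      have hdq : 0 < d * q ^ n := by positivity
      have hdp : 0 < d ^ p := by positivity
      have hstep := h.deGiorgi_step hp hγ (R₁ := R + δ * q ^ n) (ρ := R + δ * q ^ n * (3 / 4))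
        (R₂ := R + δ * q ^ (n + 1)) (T₁ := T + η * q ^ n) (T₂ := T + η * q ^ (n + 1))
        (k₁ := k - d * (1 - q ^ n)) (k₂ := k - d * (1 - q ^ (n + 1))) (r := c * q ^ n)
        (Y := θ ^ n * (ν * d ^ p)) (Γ := C * b ^ n) (by positivity) (by positivity)
        (by rw [hq1]; nlinarith) (by linarith) (by nlinarith) (by positivity)
        (by rw [hq1]; linarith) (by nlinarith) (by rw [hq1]; linarith)
        (by positivity) ?_ ih
      · refine hstep.trans (ENNReal.ofReal_le_ofReal ?_)
        have e1 : (c * q ^ n) ^ p * (C * b ^ n) = c ^ p * C := by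
          rw [Real.mul_rpow hc0.le hqn.le, hqp]
          field_simp
        have e2 : k - d * (1 - q ^ n) - (k - d * (1 - q ^ (n + 1))) = (d * q ^ n) * q := by
          rw [hq1, hq]; ring
        have e3 : ((d * q ^ n) * q) ^ p = d ^ p * (b ^ n)⁻¹ * b⁻¹ := by
          rw [Real.mul_rpow hdq.le (by norm_num [hq]), Real.mul_rpow hd.le hqn.le, hqp,
            eq_inv_of_mul_eq_one_left hqb]
        have e4 : C * b ^ n * (θ ^ n * (ν * d ^ p)) / (d ^ p * (b ^ n)⁻¹ * b⁻¹) /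
            ((c * q ^ n) ^ N * ω) = ν * (C * b / (c ^ N * ω)) := by
          have : θ ^ n = (q ^ n) ^ N / (b ^ n * b ^ n) := by
            rw [hθ, div_pow, mul_pow, ← pow_mul, ← pow_mul, mul_comm N n]
          rw [this, mul_pow]
          field_simp
        rw [e1, e2, e3, e4, pow_succ]
        have hY : 0 ≤ θ ^ n * (ν * d ^ p) := by positivity
        calc _ ≤ θ * (θ ^ n * (ν * d ^ p)) := by
              refine mul_le_mul_of_nonneg_right ?_ hY
              rw [mul_add]
              linarith
          _ = _ := by ring
      · have e1 : R + δ * q ^ n - (R + δ * q ^ n * (3 / 4)) = (δ / 4) * q ^ n := by ring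
        have e2 : T + η * q ^ n - (T + η * q ^ (n + 1)) = (η / 2) * q ^ n := by rw [hq1]; ring
        rw [e1, e2, Real.mul_rpow (by positivity) hqn.le, hqp, hC, add_mul]
        have h1 : (4 / δ) ^ p = ((δ / 4) ^ p)⁻¹ := by
          rw [← Real.inv_rpow (by positivity), inv_div]
        have h2 : 0 < (δ / 4) ^ p := by positivity
        refine add_le_add (le_of_eq ?_) ?_
        · rw [h1]; field_simp
        · have h3 : (q ^ n)⁻¹ ≤ b ^ n := by
            rw [← inv_pow]
            exact pow_le_pow_left₀ (by norm_num [hq]) (by norm_num [hq, hb2]) n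
          calc γ / (η / 2 * q ^ n) = 2 * γ / η * (q ^ n)⁻¹ := by field_simp
            _ ≤ _ := by gcongr
  have hle : ∀ n : ℕ, ∫⁻ z in cyl y s R T, ENNReal.ofReal (k - d - v z) ^ p
      ≤ ENNReal.ofReal (θ ^ n * (ν * d ^ p)) := by
    intro n
    have hqn := hq0 n
    refine le_trans ?_ (hiter n)
    refine (lintegral_mono_set (cyl_mono y s (R := R + δ * q ^ n) (T := T + η * q ^ n)
      (by have := mul_pos hδ0 hqn; linarith) (by have := mul_pos hη0 hqn; linarith))).trans
      (lintegral_mono fun z => ?_)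
    simp only
    gcongr
    nlinarith
  have hzero : ∫⁻ z in cyl y s R T, ENNReal.ofReal (k - d - v z) ^ p = 0 := by
    have h1 : Tendsto (fun n : ℕ => θ ^ n * (ν * d ^ p)) atTop (𝓝 0) := by
      simpa using (tendsto_pow_atTop_nhds_zero_of_lt_one hθ0.le hθ1).mul_const (ν * d ^ p)
    have h2 := (ENNReal.continuous_ofReal.tendsto 0).comp h1
    rw [ENNReal.ofReal_zero] at h2
    exact le_antisymm (ge_of_tendsto' h2 hle) zero_le
  have hm : Measurable fun z => ENNReal.ofReal (k - d - v z) ^ p :=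
    ((measurable_const.sub h.measurable).ennreal_ofReal).pow_const p
  rw [lintegral_eq_zero_iff hm] at hzero
  filter_upwards [hzero] with z hz
  have hz' : ENNReal.ofReal (k - d - v z) = 0 := by
    simpa [ENNReal.rpow_eq_zero_iff, hp0, hp0.not_gt] using hz
  have := ENNReal.ofReal_eq_zero.1 hz'
  linarith

/-- A function satisfying the level estimates that takes values in `(a, ∞)` is bounded away from `a`
on smaller cylinders. If `a` is finite, `|{v < a + ε}|` tends to `0` with `ε`; if `a = -∞`, the level
`-d` with `d` large is used. -/
lemma LevelEstimates.exists_ae_ge (h : LevelEstimates p γ v D y s R₀ T₀) (hp : 1 < p) (hγ : 0 < γ)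
    {R T : ℝ} (hR : 0 < R) (hRR : R < R₀) (hT : 0 < T) (hTT : T < T₀) {a : EReal} (ha : a < ⊤)
    (hva : ∀ᵐ z ∂(volume.restrict (cyl y s R₀ T₀)), a < (v z : EReal)) :
    ∃ b : ℝ, a < (b : EReal) ∧ ∀ᵐ z ∂(volume.restrict (cyl y s R T)), b ≤ v z := by
  have hp0 : 0 < p := by linarith
  obtain ⟨ν, hν0, hν⟩ := h.ae_ge_of_small hp hγ hR hRR hT hTT
  induction a with
  | top => exact absurd ha (lt_irrefl _)
  | bot =>
    set I := ∫⁻ z in cyl y s R₀ T₀, ENNReal.ofReal (0 - v z) ^ p with hI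
    have hfin : I ≠ ∞ := by
      have h1 := h.hasSpatialGradient.memLp.eLpNorm_lt_top
      rw [eLpNorm_lt_top_iff_lintegral_rpow_enorm_lt_top (by simpa using hp0)
        ENNReal.ofReal_ne_top, ENNReal.toReal_ofReal hp0.le] at h1
      refine ne_top_of_le_ne_top h1.ne (lintegral_mono fun z => ?_)
      simp only
      gcongr
      rw [← ofReal_norm, Real.norm_eq_abs]
      exact ENNReal.ofReal_le_ofReal (by rw [zero_sub]; exact neg_le_abs _)
    have htend : Tendsto (fun d : ℝ => ν * d ^ p) atTop atTop :=
      (tendsto_rpow_atTop hp0).const_mul_atTop hν0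
    obtain ⟨d, hd1, hd0⟩ := ((htend.eventually_ge_atTop I.toReal).and
      (eventually_gt_atTop 0)).exists
    refine ⟨0 - d, EReal.bot_lt_coe _, hν 0 d hd0 ?_⟩
    exact ENNReal.le_ofReal_iff_toReal_le hfin (by positivity) |>.2 hd1
  | coe a =>
    set μ := (volume : Measure (SpaceTime N)).restrict (cyl y s R₀ T₀) with hμ
    set ε : ℕ → ℝ := fun n => 1 / ((n : ℝ) + 1) with hε
    have hε0 : ∀ n, 0 < ε n := fun n => Nat.one_div_pos_of_nat
    have hmono : Antitone fun n => {z | v z < a + 2 * ε n} := by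
      intro n m hnm z hz
      have : ε m ≤ ε n := one_div_le_one_div_of_le (by positivity) (by exact_mod_cast by omega)
      simp only [mem_ofPred_eq] at hz ⊢
      linarith
    have hlim := tendsto_measure_iInter_atTop (μ := μ) (s := fun n => {z | v z < a + 2 * ε n})
      (fun n => (h.measurable measurableSet_Iio).nullMeasurableSet) hmono ⟨0, measure_ne_top _ _⟩
    have hzero : μ (⋂ n, {z | v z < a + 2 * ε n}) = 0 := by
      refine measure_mono_null ?_ (ae_iff.1 hva)
      intro z hz
      simp only [mem_iInter, mem_ofPred_eq] at hz
      simp only [mem_ofPred_eq, EReal.coe_lt_coe_iff, not_lt]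
      have ht : Tendsto (fun n => a + 2 * ε n) atTop (𝓝 (a + 2 * 0)) :=
        (tendsto_one_div_add_atTop_nhds_zero_nat.const_mul 2).const_add a
      rw [mul_zero, add_zero] at ht
      exact ge_of_tendsto' ht fun n => (hz n).le
    rw [hzero] at hlim
    have hlim2 : Tendsto (fun n => (2 : ℝ≥0∞) ^ p * μ {z | v z < a + 2 * ε n}) atTop (𝓝 0) := by
      have := ENNReal.Tendsto.const_mul (a := (2 : ℝ≥0∞) ^ p) hlim (Or.inr (by finiteness))
      rwa [mul_zero] at this
    obtain ⟨n, hn⟩ := (hlim2.eventually_le_const (ENNReal.ofReal_pos.2 hν0)).exists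
    refine ⟨a + 2 * ε n - ε n, ?_, hν _ _ (hε0 n) ?_⟩
    · have := hε0 n
      exact EReal.coe_lt_coe_iff.2 (by linarith)
    · have hS : MeasurableSet {z | v z < a + 2 * ε n} := h.measurable measurableSet_Iio
      calc ∫⁻ z, ENNReal.ofReal (a + 2 * ε n - v z) ^ p ∂μ
          ≤ ∫⁻ z, {z | v z < a + 2 * ε n}.indicator
              (fun _ => ENNReal.ofReal (2 * ε n) ^ p) z ∂μ := by
            refine lintegral_mono_ae ?_
            filter_upwards [hva] with z hz
            have hz' : a < v z := EReal.coe_lt_coe_iff.1 hz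
            by_cases hzn : v z < a + 2 * ε n
            · rw [indicator_of_mem (by exact hzn)]
              gcongr
              linarith
            · rw [ENNReal.ofReal_of_nonpos (by linarith), ENNReal.zero_rpow_of_pos hp0]
              exact zero_le
        _ = ENNReal.ofReal (2 * ε n) ^ p * μ {z | v z < a + 2 * ε n} :=
            lintegral_indicator_const hS _
        _ = (2 ^ p * μ {z | v z < a + 2 * ε n}) * ENNReal.ofReal (ε n ^ p) := by
            rw [ENNReal.ofReal_mul zero_le_two, ENNReal.mul_rpow_of_nonneg _ _ hp0.le,
              ENNReal.ofReal_rpow_of_pos (hε0 n), ENNReal.ofReal_ofNat]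
            ring
        _ ≤ ENNReal.ofReal ν * ENNReal.ofReal (ε n ^ p) := by gcongr
        _ = _ := (ENNReal.ofReal_mul hν0.le).symm

/-- A cylinder compactly contained in an open set can be enlarged within this set. -/
lemma exists_larger_cyl {R T : ℝ} (hR : 0 < R) (hT : 0 < T) {E : Set (SpaceTime N)} (hE : IsOpen E)
    (h : closure (cyl y s R T) ⊆ E) :
    ∃ R' T', R < R' ∧ T < T' ∧ closure (cyl y s R' T') ⊆ E := by
  set ε : ℕ → ℝ := fun n => 1 / ((n : ℝ) + 1) with hε
  have hε0 : ∀ n, 0 < ε n := fun n => Nat.one_div_pos_of_nat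
  have hεt : Tendsto ε atTop (𝓝 0) := tendsto_one_div_add_atTop_nhds_zero_nat
  have hanti : Antitone ε := fun n m hnm =>
    one_div_le_one_div_of_le (by positivity) (by exact_mod_cast by omega)
  set K : ℕ → Set (SpaceTime N) := fun n =>
    closedCube y (R + ε n) ×ˢ Icc (s - (T + ε n)) s with hK
  have hKc : ∀ n, IsCompact (K n) := fun n => (isCompact_closedCube _ _).prod isCompact_Icc
  have hKa : Antitone K := by
    intro n m hnm
    refine prod_mono (fun x hx i => (hx i).trans ?_) (Icc_subset_Icc_left ?_) <;>
    linarith [hanti hnm]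
  have hcl : closedCube y R ⊆ closure (cube y R) := by
    intro x hx
    have ht : Tendsto (fun l : ℝ => y + l • (x - y)) (𝓝[<] 1) (𝓝 x) := by
      have hc : Continuous fun l : ℝ => y + l • (x - y) := by fun_prop
      have := (hc.tendsto 1).mono_left (nhdsWithin_le_nhds (s := Iio 1))
      simpa using this
    refine mem_closure_of_tendsto ht ?_
    have h0 : ∀ᶠ l : ℝ in 𝓝[<] 1, 0 < l := nhdsWithin_le_nhds (lt_mem_nhds one_pos)
    filter_upwards [h0, self_mem_nhdsWithin] with l hl hl1 i
    have h1 : (y + l • (x - y)) i - y i = l * (x i - y i) := by simp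
    rw [h1, abs_mul, abs_of_pos hl]
    have h2 := hx i
    have h3 : l < 1 := hl1
    nlinarith [abs_nonneg (x i - y i)]
  have hinter : ⋂ n, K n ⊆ E := by
    refine Subset.trans ?_ h
    intro z hz
    rw [mem_iInter] at hz
    rw [cyl, closure_prod_eq, closure_Ioc (by linarith)]
    refine ⟨hcl fun i => ?_, ?_, (hz 0).2.2⟩
    · have ht : Tendsto (fun n => R + ε n) atTop (𝓝 R) := by simpa using hεt.const_add R
      exact ge_of_tendsto' ht fun n => (hz n).1 i
    · have ht : Tendsto (fun n => s - (T + ε n)) atTop (𝓝 (s - T)) := by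
        simpa using (hεt.const_add T).const_sub s
      exact le_of_tendsto' ht fun n => (hz n).2.1
  obtain ⟨n, hn⟩ := exists_subset_nhds_of_isCompact (V := K) hKa.directed_ge hKc
    (U := E) fun z hz => hE.mem_nhds (hinter hz)
  refine ⟨R + ε n, T + ε n, by linarith [hε0 n], by linarith [hε0 n], Subset.trans ?_ hn⟩
  exact closure_minimal (prod_mono (cube_subset_closedCube _ _) Ioc_subset_Icc_self)
    (hKc n).isClosed

end

/-! ### Convex functions as superpositions of truncations -/

/-- The negative of the right derivative; nonnegative and nonincreasing for a convex nonincreasing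
function. -/
noncomputable def rightSlope (ψ : ℝ → ℝ) (r : ℝ) : ℝ := -derivWithin ψ (Ioi r) r

/-- The slope of the steepest line through `(k, 0)` that stays below `ψ` on `(-∞, k)`. -/
noncomputable def tangentSlope (ψ : ℝ → ℝ) (k : ℝ) : ℝ := ⨅ t : Ioi (0 : ℝ), ψ (k - t) / t

section

variable {ψ : ℝ → ℝ}

lemma hasDerivWithinAt_rightSlope (hc : ConvexOn ℝ univ ψ) (r : ℝ) :
    HasDerivWithinAt ψ (-rightSlope ψ r) (Ioi r) r := by
  rw [rightSlope, neg_neg]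
  exact hc.hasDerivWithinAt_rightDeriv_of_mem_interior (by simp)

lemma antitone_rightSlope (hc : ConvexOn ℝ univ ψ) : Antitone (rightSlope ψ) := fun a b hab => by
  have := hc.monotoneOn_rightDeriv (a := a) (b := b) (by simp) (by simp) hab
  exact neg_le_neg this

/-- The graph of a convex function lies above its right tangents. -/
lemma tangent_le_of_mem_interior {S : Set ℝ} (hc : ConvexOn ℝ S ψ) {k w : ℝ} (hk : k ∈ interior S)
    (hw : w ∈ S) : ψ k + rightSlope ψ k * (k - w) ≤ ψ w := by
  rcases lt_trichotomy w k with h | rfl | h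
  · have h1 := hc.slope_le_leftDeriv_of_mem_interior hw hk h
    have h2 := hc.leftDeriv_le_rightDeriv_of_mem_interior hk
    have h3 := h1.trans h2
    rw [slope_def_field, div_le_iff₀ (by linarith)] at h3
    rw [rightSlope]
    linarith
  · simp
  · have h1 := hc.rightDeriv_le_slope_of_mem_interior hk hw h
    rw [slope_def_field, le_div_iff₀ (by linarith)] at h1
    rw [rightSlope]
    linarith

lemma tangent_le (hc : ConvexOn ℝ univ ψ) (k w : ℝ) : ψ k + rightSlope ψ k * (k - w) ≤ ψ w :=
  tangent_le_of_mem_interior hc (by simp) (mem_univ w)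

lemma rightSlope_nonneg (hc : ConvexOn ℝ univ ψ) (ha : Antitone ψ) (r : ℝ) :
    0 ≤ rightSlope ψ r := by
  have h1 := hc.rightDeriv_le_slope_of_mem_interior (x := r) (by simp) (mem_univ (r + 1))
    (by linarith)
  have h2 := ha (show r ≤ r + 1 by linarith)
  rw [slope_def_field] at h1
  rw [rightSlope]
  have h3 : (ψ (r + 1) - ψ r) / (r + 1 - r) ≤ 0 :=
    div_nonpos_of_nonpos_of_nonneg (by linarith) (by linarith)
  linarith

lemma continuous_of_convexOn_univ (hc : ConvexOn ℝ univ ψ) : Continuous ψ :=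
  continuousOn_univ.1 (hc.continuousOn isOpen_univ)

/-- The right slope is lower semicontinuous from the right. -/
lemma exists_gt_lt_rightSlope (hc : ConvexOn ℝ univ ψ) {c r : ℝ} (h : c < rightSlope ψ r) :
    ∃ r', r < r' ∧ c < rightSlope ψ r' := by
  have h1 := hasDerivWithinAt_iff_tendsto_slope.1 (hasDerivWithinAt_rightSlope hc r)
  rw [sdiff_singleton_eq_self (by simp)] at h1
  obtain ⟨w, hw1, hw2⟩ := ((h1.eventually (gt_mem_nhds (neg_lt_neg h))).and
    self_mem_nhdsWithin).exists
  have hw : r < w := hw2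
  have hcont := continuous_of_convexOn_univ hc
  have h2 : ContinuousAt (fun r' => (ψ w - ψ r') / (w - r')) r :=
    (continuousAt_const.sub hcont.continuousAt).div (continuousAt_const.sub continuousAt_id)
      (by simpa using (sub_pos.2 hw).ne')
  rw [slope_def_field] at hw1
  have h3 : ∀ᶠ r' in 𝓝[>] r, (ψ w - ψ r') / (w - r') < -c :=
    nhdsWithin_le_nhds (h2.eventually (gt_mem_nhds hw1))
  have h4 : ∀ᶠ r' in 𝓝[>] r, r' < w := nhdsWithin_le_nhds (gt_mem_nhds hw)
  obtain ⟨r', h5, h6, h7⟩ := (h3.and (h4.and self_mem_nhdsWithin)).exists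
  refine ⟨r', h7, ?_⟩
  have h8 := hc.rightDeriv_le_slope_of_mem_interior (x := r') (by simp) (mem_univ w) h6
  rw [slope_def_field] at h8
  rw [rightSlope]
  linarith

lemma bddBelow_tangentSlope (h0 : ∀ r, 0 ≤ ψ r) (k : ℝ) :
    BddBelow (range fun t : Ioi (0 : ℝ) => ψ (k - t) / t) :=
  ⟨0, by rintro _ ⟨t, rfl⟩; exact div_nonneg (h0 _) (le_of_lt t.2)⟩

lemma le_tangentSlope {k c : ℝ} (h : ∀ t, 0 < t → c * t ≤ ψ (k - t)) : c ≤ tangentSlope ψ k :=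
  haveI : Nonempty (Ioi (0 : ℝ)) := ⟨⟨1, mem_Ioi.2 one_pos⟩⟩
  le_ciInf fun t => (le_div_iff₀ t.2).2 (h t t.2)

lemma tangentSlope_mul_le (h0 : ∀ r, 0 ≤ ψ r) (k : ℝ) {t : ℝ} (ht : 0 < t) :
    tangentSlope ψ k * t ≤ ψ (k - t) :=
  (le_div_iff₀ ht).1 (ciInf_le (bddBelow_tangentSlope h0 k) ⟨t, ht⟩)

lemma tangentSlope_nonneg (h0 : ∀ r, 0 ≤ ψ r) (k : ℝ) : 0 ≤ tangentSlope ψ k :=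
  le_tangentSlope fun t _ => by simpa using h0 _

lemma antitone_tangentSlope (h0 : ∀ r, 0 ≤ ψ r) (ha : Antitone ψ) : Antitone (tangentSlope ψ) :=
  fun _ _ hab => le_tangentSlope fun _ ht =>
    (tangentSlope_mul_le h0 _ ht).trans (ha (by linarith))

lemma rightSlope_le_tangentSlope (hc : ConvexOn ℝ univ ψ) (h0 : ∀ r, 0 ≤ ψ r) (k : ℝ) :
    rightSlope ψ k ≤ tangentSlope ψ k :=
  le_tangentSlope fun t _ => by
    have h1 := tangent_le hc k (k - t)
    have h2 := h0 k
    rw [sub_sub_cancel] at h1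
    linarith

/-- If `ψ` has dropped to half of its value at `u` before `k`, then the steepest line through `(k, 0)`
below `ψ` is at least `ψ k` at `u`. -/
lemma le_tangentSlope_mul (hc : ConvexOn ℝ univ ψ) (ha : Antitone ψ) (h0 : ∀ r, 0 ≤ ψ r) {u k : ℝ}
    (huk : u < k) (h : ψ k ≤ ψ u / 2) : ψ k ≤ tangentSlope ψ k * (k - u) := by
  have hku : 0 < k - u := by linarith
  rw [← div_le_iff₀ hku]
  refine le_tangentSlope fun t ht => ?_
  rw [div_mul_eq_mul_div, div_le_iff₀ hku]
  rcases le_total t (k - u) with htu | htu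
  · have h1 : ψ k ≤ ψ (k - t) := ha (by linarith)
    have h2 := h0 k
    calc ψ k * t ≤ ψ k * (k - u) := by gcongr
      _ ≤ _ := by gcongr
  · rcases htu.eq_or_lt with rfl | htu
    · rw [sub_sub_cancel]
      have := h0 u
      gcongr
      linarith
    · -- the chord through `(u, ψ u)` and `(k, ψ k)` lies below `ψ` to the left of `u`
      have h1 := hc.slope_mono_adjacent (mem_univ (k - t)) (mem_univ k) (y := u) (by linarith) huk
      rw [div_le_div_iff₀ (by linarith) hku] at h1
      have h2 := h0 k
      nlinarith

lemma tendsto_rightSlope (hc : ConvexOn ℝ univ ψ) (ha : Antitone ψ)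
    (ht : Tendsto ψ atTop (𝓝 0)) : Tendsto (rightSlope ψ) atTop (𝓝 0) := by
  have h0 : ∀ r, 0 ≤ ψ r := ha.le_of_tendsto ht
  have h1 : Tendsto (fun r => ψ (r + -1)) atTop (𝓝 0) :=
    ht.comp (tendsto_atTop_add_const_right _ _ tendsto_id)
  refine squeeze_zero (rightSlope_nonneg hc ha) (fun r => ?_) h1
  have h2 := tangent_le hc r (r + -1)
  have h3 := h0 r
  linarith

/-- A fundamental theorem of calculus on a half-line for a continuous function with nonincreasing
nonnegative one-sided slope. -/
lemma lintegral_Ioi_of_hasDerivWithinAt {g e : ℝ → ℝ} (hg : Continuous g)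
    (hd : ∀ r, HasDerivWithinAt g (-e r) (Ioi r) r) (he : Antitone e) (he0 : ∀ r, 0 ≤ e r)
    (ht : Tendsto g atTop (𝓝 0)) (a : ℝ) :
    ∫⁻ v in Ioi a, ENNReal.ofReal (e v) = ENNReal.ofReal (g a) := by
  have hcover : AECover (volume.restrict (Ioi a)) atTop fun n : ℕ => Iic (a + n) :=
    aecover_Iic (tendsto_atTop_add_const_left _ _ tendsto_natCast_atTop_atTop)
  have h1 := hcover.lintegral_tendsto_of_countably_generated
    (f := fun v => ENNReal.ofReal (e v)) he.measurable.ennreal_ofReal.aemeasurable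
  refine tendsto_nhds_unique h1 ?_
  have h2 : ∀ n : ℕ, ∫⁻ v in Iic (a + n), ENNReal.ofReal (e v) ∂(volume.restrict (Ioi a))
      = ENNReal.ofReal (g a - g (a + n)) := by
    intro n
    have hle : a ≤ a + n := by simp
    have hi : IntervalIntegrable e volume a (a + n) := he.intervalIntegrable
    have hftc := intervalIntegral.integral_eq_sub_of_hasDeriv_right (f := g) (f' := fun v => -e v)
      hg.continuousOn (fun x _ => hd x) hi.neg
    rw [intervalIntegral.integral_neg] at hftc
    rw [Measure.restrict_restrict measurableSet_Iic, inter_comm, Ioi_inter_Iic,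
      ← ofReal_integral_eq_lintegral_ofReal ((intervalIntegrable_iff_integrableOn_Ioc_of_le hle).1 hi)
      (ae_of_all _ he0), ← intervalIntegral.integral_of_le hle]
    congr 1
    linarith
  simp_rw [h2]
  have h3 : Tendsto (fun n : ℕ => g a - g (a + n)) atTop (𝓝 (g a - 0)) :=
    (ht.comp (tendsto_atTop_add_const_left _ _ tendsto_natCast_atTop_atTop)).const_sub _
  rw [sub_zero] at h3
  exact (ENNReal.continuous_ofReal.tendsto _).comp h3

/-- The `p`-th power of the slope of a convex nonincreasing function `ψ` vanishing at infinity, and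
`ψ ^ p` itself, are comparable with superpositions of `1_{r < k}` and of `(k - r)_+ ^ p` with the
*same* measure `ν(dk)`. If `s` is the right slope and `σ` the tangent slope, then
`ν = -d(σ ^ (p - 1) s)`: the layer-cake formula turns the last integral into
`p ∫_r^∞ (v - r) ^ (p - 1) σ(v) ^ (p - 1) s(v) dv`, where `(v - r) σ(v) ≤ ψ(r)` for all `v`, and
`(v - r) σ(v) ≥ ψ(v)` as soon as `ψ(v) ≤ ψ(r) / 2`. -/
theorem exists_superposition {p : ℝ} (hp : 1 < p) (hc : ConvexOn ℝ univ ψ) (ha : Antitone ψ)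
    (ht : Tendsto ψ atTop (𝓝 0)) :
    ∃ ν : Measure ℝ, SFinite ν ∧ ∀ r : ℝ,
      ENNReal.ofReal (rightSlope ψ r) ^ p ≤ ν (Ioi r) ∧
      ENNReal.ofReal (ψ r) ^ p ≤ 2 ^ p * ∫⁻ k, ENNReal.ofReal (k - r) ^ p ∂ν ∧
      ∫⁻ k, ENNReal.ofReal (k - r) ^ p ∂ν ≤ ENNReal.ofReal p * ENNReal.ofReal (ψ r) ^ p := by
  have hp0 : 0 < p := by linarith
  have hp1 : 0 < p - 1 := by linarith
  have h0 : ∀ r, 0 ≤ ψ r := ha.le_of_tendsto ht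
  have hcont := continuous_of_convexOn_univ hc
  set s := rightSlope ψ with hs
  set σ := tangentSlope ψ with hσ
  have hs0 : ∀ r, 0 ≤ s r := rightSlope_nonneg hc ha
  have hsa : Antitone s := antitone_rightSlope hc
  have hσ0 : ∀ r, 0 ≤ σ r := tangentSlope_nonneg h0
  have hσa : Antitone σ := antitone_tangentSlope h0 ha
  set h : ℝ → ℝ := fun v => σ v ^ (p - 1) * s v with hh
  have hh0 : ∀ v, 0 ≤ h v := fun v => mul_nonneg (Real.rpow_nonneg (hσ0 v) _) (hs0 v)
  have hha : Antitone h := fun a b hab => by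
    have h1 := hσ0 b
    have h2 := hs0 b
    have h3 := Real.rpow_nonneg (hσ0 a) (p - 1)
    exact mul_le_mul (Real.rpow_le_rpow h1 (hσa hab) hp1.le) (hsa hab) h2 h3
  have hht : Tendsto h atTop (𝓝 0) := by
    have h1 : Tendsto (fun v => σ 0 ^ (p - 1) * s v) atTop (𝓝 0) := by
      simpa using (tendsto_rightSlope hc ha ht).const_mul (σ 0 ^ (p - 1))
    refine tendsto_of_tendsto_of_tendsto_of_le_of_le' tendsto_const_nhds h1
      (Eventually.of_forall hh0) ?_
    filter_upwards [eventually_ge_atTop 0] with v hv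
    exact mul_le_mul_of_nonneg_right (Real.rpow_le_rpow (hσ0 v) (hσa hv) hp1.le) (hs0 v)
  have hmono : Monotone fun v => -h v := fun a b hab => neg_le_neg (hha hab)
  set f := hmono.stieltjesFunction with hf
  -- `H` is the right limit of `h`
  set H : ℝ → ℝ := fun v => -f v with hH
  have hHle : ∀ v, H v ≤ h v := fun v => by
    have := hmono.le_rightLim (le_refl v)
    rw [hH, hf]
    simp only [hmono.stieltjesFunction_eq]
    linarith
  have hleH : ∀ v v', v < v' → h v' ≤ H v := fun v v' hv => by
    have := hmono.rightLim_le hv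
    rw [hH, hf]
    simp only [hmono.stieltjesFunction_eq]
    linarith
  have hH0 : ∀ v, 0 ≤ H v := fun v => (hh0 (v + 1)).trans (hleH v (v + 1) (by linarith))
  have hHt : Tendsto (f : ℝ → ℝ) atTop (𝓝 0) := by
    have h1 : Tendsto H atTop (𝓝 0) := squeeze_zero hH0 hHle hht
    simpa [hH] using h1.neg
  have hae : ∀ᵐ v, H v = h v := by
    have h1 : ∀ᵐ v, ContinuousAt (fun v => -h v) v :=
      (hmono.countable_not_continuousAt.ae_notMem volume).mono fun v hv => not_not.1 hv
    filter_upwards [h1] with v hv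
    rw [hH, hf]
    simp only [hmono.stieltjesFunction_eq]
    rw [hv.continuousWithinAt.rightLim_eq, neg_neg]
  have hν : ∀ v, f.measure (Ioi v) = ENNReal.ofReal (H v) := fun v => by
    rw [f.measure_Ioi hHt, zero_sub]
  have hlayer : ∀ r, ∫⁻ k, ENNReal.ofReal (k - r) ^ p ∂f.measure
      = ENNReal.ofReal p * ∫⁻ v in Ioi r, ENNReal.ofReal (h v * (v - r) ^ (p - 1)) := by
    intro r
    have h1 := lintegral_rpow_eq_lintegral_meas_lt_mul f.measure (f := fun k => max (k - r) 0)
      (ae_of_all _ fun k => le_max_right _ _)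
      (by fun_prop) hp0
    have h2 : ∀ k : ℝ, ENNReal.ofReal (k - r) ^ p = ENNReal.ofReal (max (k - r) 0 ^ p) := by
      intro k
      rw [← ENNReal.ofReal_rpow_of_nonneg (le_max_right _ _) hp0.le, ENNReal.ofReal_max,
        ENNReal.ofReal_zero, max_eq_left zero_le]
    simp_rw [h2]
    rw [h1]
    congr 1
    have h3 : ∫⁻ t in Ioi (0 : ℝ), f.measure {a | t < max (a - r) 0} * ENNReal.ofReal (t ^ (p - 1))
        = ∫⁻ t in Ioi (0 : ℝ), ENNReal.ofReal (H (t + r) * (t + r - r) ^ (p - 1)) := by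
      refine setLIntegral_congr_fun measurableSet_Ioi fun t ht => ?_
      have ht0 : (0 : ℝ) < t := ht
      have h4 : {a | t < max (a - r) 0} = Ioi (t + r) := by
        ext a
        simp only [mem_ofPred_eq, lt_max_iff, ht0.not_gt, or_false, mem_Ioi]
        exact lt_sub_iff_add_lt
      rw [h4, hν, add_sub_cancel_right, ENNReal.ofReal_mul (hH0 _)]
    have h5 : ∫⁻ t in Ioi (0 : ℝ), ENNReal.ofReal (H (t + r) * (t + r - r) ^ (p - 1))
        = ∫⁻ v in Ioi r, ENNReal.ofReal (H v * (v - r) ^ (p - 1)) := by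
      rw [← lintegral_indicator measurableSet_Ioi, ← lintegral_indicator measurableSet_Ioi,
        ← lintegral_add_right_eq_self
          ((Ioi r).indicator fun v => ENNReal.ofReal (H v * (v - r) ^ (p - 1))) r]
      refine lintegral_congr fun t => ?_
      by_cases ht0 : 0 < t
      · rw [indicator_of_mem (by exact ht0), indicator_of_mem (by simpa using ht0)]
      · rw [indicator_of_notMem (by exact ht0), indicator_of_notMem (by simpa using ht0)]
    rw [h3, h5]
    refine lintegral_congr_ae (ae_restrict_of_ae ?_)
    filter_upwards [hae] with v hv
    rw [hv]
  refine ⟨f.measure, inferInstance, fun r => ⟨?_, ?_, ?_⟩⟩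
  · rw [hν, ENNReal.ofReal_rpow_of_nonneg (hs0 r) hp0.le]
    refine ENNReal.ofReal_le_ofReal (not_lt.1 fun hlt => ?_)
    have h1 : H r ^ (1 / p) < s r := by
      rw [one_div]
      exact (Real.rpow_inv_lt_iff_of_pos (hH0 r) (hs0 r) hp0).2 hlt
    obtain ⟨r', hr', h2⟩ := exists_gt_lt_rightSlope hc h1
    have h3 : s r' ^ p ≤ h r' := by
      have h4 : s r' ^ p = s r' ^ (p - 1) * s r' := by
        rw [← Real.rpow_add_one' (hs0 _) (by linarith), sub_add_cancel]
      rw [h4]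
      exact mul_le_mul_of_nonneg_right (Real.rpow_le_rpow (hs0 _)
        (rightSlope_le_tangentSlope hc h0 r') hp1.le) (hs0 _)
    have h4 : H r < s r' ^ p := by
      rw [one_div] at h2
      exact (Real.rpow_inv_lt_iff_of_pos (hH0 r) (hs0 r') hp0).1 h2
    linarith [hleH r r' hr']
  · rcases (h0 r).eq_or_lt with hr | hr
    · rw [← hr, ENNReal.ofReal_zero, ENNReal.zero_rpow_of_pos hp0]
      exact zero_le
    obtain ⟨m, hm⟩ : ∃ m, ψ m = ψ r / 2 := by
      obtain ⟨x, hx1, hx2⟩ := ((ht.eventually (gt_mem_nhds (show (0 : ℝ) < ψ r / 2 by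
        linarith))).and (eventually_ge_atTop r)).exists
      obtain ⟨m, -, hm⟩ := intermediate_value_Icc' hx2 hcont.continuousOn
        (show ψ r / 2 ∈ Icc (ψ x) (ψ r) from ⟨hx1.le, by linarith⟩)
      exact ⟨m, hm⟩
    have hrm : r ≤ m := by
      by_contra hcon
      have := ha (not_le.1 hcon).le
      linarith
    -- the integral over `(m, ∞)` is that of an exact derivative
    have hpow : ∫⁻ v in Ioi m, ENNReal.ofReal (s v * p * ψ v ^ (p - 1))
        = ENNReal.ofReal (ψ m ^ p) := by
      refine lintegral_Ioi_of_hasDerivWithinAt (g := fun v => ψ v ^ p)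
        (hcont.rpow_const fun _ => Or.inr hp0.le) (fun v => ?_) (fun a b hab => ?_) (fun v => ?_) ?_ m
      · have := (hasDerivWithinAt_rightSlope hc v).rpow_const (p := p) (Or.inr hp.le)
        convert this using 1
        ring
      · have h1 := hs0 b
        have h2 := h0 b
        have h3 := hs0 a
        exact mul_le_mul (mul_le_mul_of_nonneg_right (hsa hab) hp0.le)
          (Real.rpow_le_rpow h2 (ha hab) hp1.le) (Real.rpow_nonneg h2 _) (by positivity)
      · exact mul_nonneg (mul_nonneg (hs0 v) hp0.le) (Real.rpow_nonneg (h0 v) _)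
      · have h1 : Tendsto (fun v => ψ v ^ p) atTop (𝓝 (0 ^ p)) :=
          (Real.continuousAt_rpow_const 0 p (Or.inr hp0.le)).tendsto.comp ht
        rwa [Real.zero_rpow hp0.ne'] at h1
    have hle : ENNReal.ofReal (ψ m ^ p) ≤ ∫⁻ k, ENNReal.ofReal (k - r) ^ p ∂f.measure := by
      rw [hlayer, ← hpow, ← lintegral_const_mul' _ _ ENNReal.ofReal_ne_top]
      refine le_trans ?_ (lintegral_mono_set (Ioi_subset_Ioi hrm))
      refine setLIntegral_mono' measurableSet_Ioi fun v hv => ?_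
      have hmv : m < v := hv
      rw [← ENNReal.ofReal_mul hp0.le]
      refine ENNReal.ofReal_le_ofReal ?_
      have h1 : ψ v ≤ σ v * (v - r) := le_tangentSlope_mul hc ha h0 (by linarith)
        ((ha hmv.le).trans hm.le)
      have h2 : ψ v ^ (p - 1) ≤ σ v ^ (p - 1) * (v - r) ^ (p - 1) := by
        rw [← Real.mul_rpow (hσ0 v) (by linarith)]
        exact Real.rpow_le_rpow (h0 v) h1 hp1.le
      calc s v * p * ψ v ^ (p - 1) ≤ s v * p * (σ v ^ (p - 1) * (v - r) ^ (p - 1)) :=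
            mul_le_mul_of_nonneg_left h2 (mul_nonneg (hs0 v) hp0.le)
        _ = p * (h v * (v - r) ^ (p - 1)) := by rw [hh]; ring
    calc ENNReal.ofReal (ψ r) ^ p = 2 ^ p * ENNReal.ofReal (ψ m ^ p) := by
          rw [← ENNReal.ofReal_rpow_of_nonneg (h0 m) hp0.le,
            ← ENNReal.mul_rpow_of_nonneg _ _ hp0.le, hm,
            ← ENNReal.ofReal_ofNat 2, ← ENNReal.ofReal_mul zero_le_two]
          congr 2
          ring
      _ ≤ _ := by gcongr
  · rw [hlayer]
    gcongr
    have hψr := Real.rpow_nonneg (h0 r) (p - 1)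
    calc ∫⁻ v in Ioi r, ENNReal.ofReal (h v * (v - r) ^ (p - 1))
        ≤ ∫⁻ v in Ioi r, ENNReal.ofReal (ψ r ^ (p - 1)) * ENNReal.ofReal (s v) := by
          refine setLIntegral_mono' measurableSet_Ioi fun v hv => ?_
          have hrv : 0 < v - r := sub_pos.2 hv
          rw [← ENNReal.ofReal_mul hψr]
          refine ENNReal.ofReal_le_ofReal ?_
          have h1 := tangentSlope_mul_le h0 v hrv
          rw [sub_sub_cancel] at h1
          calc h v * (v - r) ^ (p - 1) = (σ v * (v - r)) ^ (p - 1) * s v := by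
                rw [Real.mul_rpow (hσ0 v) hrv.le, hh]; ring
            _ ≤ ψ r ^ (p - 1) * s v := mul_le_mul_of_nonneg_right
                (Real.rpow_le_rpow (mul_nonneg (hσ0 v) hrv.le) h1 hp1.le) (hs0 v)
      _ = ENNReal.ofReal (ψ r ^ (p - 1)) * ENNReal.ofReal (ψ r) := by
          rw [lintegral_const_mul' _ _ ENNReal.ofReal_ne_top, lintegral_Ioi_of_hasDerivWithinAt hcont
            (hasDerivWithinAt_rightSlope hc) hsa hs0 ht]
      _ = ENNReal.ofReal (ψ r) ^ p := by
          rw [← ENNReal.ofReal_mul hψr, ENNReal.ofReal_rpow_of_nonneg (h0 r) hp0.le]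
          congr 1
          rw [← Real.rpow_add_one' (h0 r) (by linarith), sub_add_cancel]

end

/-! ### Energy estimates for convex functions -/

section

variable {N : ℕ} {p γ : ℝ} {v : SpaceTime N → ℝ} {D : SpaceTime N → Eucl N} {y : Eucl N}
  {s R₀ T₀ : ℝ}

/-- Energy estimates for `ψ(v)`, with `ψ` convex, nonincreasing and vanishing at infinity. The
estimates for `(v - k)_-` are integrated against the measure `ν(dk)` of `exists_superposition`: all
of them are linear in the `p`-th powers. -/
lemma LevelEstimates.energy_convex (h : LevelEstimates p γ v D y s R₀ T₀) (hp : 1 < p)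
    {ψ : ℝ → ℝ} (hc : ConvexOn ℝ univ ψ) (ha : Antitone ψ) (ht : Tendsto ψ atTop (𝓝 0))
    {R T ρ τ : ℝ} (hρ : 0 < ρ) (hρR : ρ < R) (hR : R ≤ R₀) (hτ : 0 < τ) (hτT : τ < T)
    (hT : T ≤ T₀) :
    (∀ᵐ t ∂(volume.restrict (Ioc (s - τ) s)),
      ∫⁻ x in cube y ρ, ENNReal.ofReal (ψ (v (x, t))) ^ p
        ≤ 2 ^ p * ENNReal.ofReal p * ENNReal.ofReal (γ / (R - ρ) ^ p + γ / (T - τ)) *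
          ∫⁻ z in cyl y s R T, ENNReal.ofReal (ψ (v z)) ^ p) ∧
    ∫⁻ z in cyl y s ρ τ, ENNReal.ofReal (rightSlope ψ (v z)) ^ p * ‖D z‖ₑ ^ p
      ≤ ENNReal.ofReal p * ENNReal.ofReal (γ / (R - ρ) ^ p + γ / (T - τ)) *
          ∫⁻ z in cyl y s R T, ENNReal.ofReal (ψ (v z)) ^ p := by
  obtain ⟨ν, hν, hsup⟩ := exists_superposition hp hc ha ht
  set Γ := ENNReal.ofReal (γ / (R - ρ) ^ p + γ / (T - τ)) with hΓ
  set I : ℝ → ℝ≥0∞ := fun k => ∫⁻ z in cyl y s R T, ENNReal.ofReal (k - v z) ^ p with hI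
  have hvm := h.measurable
  have hkz : Measurable fun q : ℝ × SpaceTime N => ENNReal.ofReal (q.1 - v q.2) ^ p :=
    ((measurable_fst.sub (hvm.comp measurable_snd)).ennreal_ofReal).pow_const p
  have hIm : Measurable I := hkz.lintegral_prod_right'
  have hIle : ∫⁻ k, Γ * I k ∂ν ≤ ENNReal.ofReal p * Γ *
      ∫⁻ z in cyl y s R T, ENNReal.ofReal (ψ (v z)) ^ p := by
    rw [lintegral_const_mul' _ _ ENNReal.ofReal_ne_top, hI, lintegral_lintegral_swap
      hkz.aemeasurable, mul_comm (ENNReal.ofReal p), mul_assoc,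
      ← lintegral_const_mul' (ENNReal.ofReal p) _ ENNReal.ofReal_ne_top]
    exact mul_le_mul_right (lintegral_mono fun z => (hsup (v z)).2.2) _
  constructor
  · set F : ℝ × ℝ → ℝ≥0∞ := fun q => ∫⁻ x in cube y ρ, ENNReal.ofReal (q.1 - v (x, q.2)) ^ p with hF
    have hFm' : Measurable fun q : (ℝ × ℝ) × Eucl N =>
        ENNReal.ofReal (q.1.1 - v (q.2, q.1.2)) ^ p :=
      (((measurable_fst.comp measurable_fst).sub (hvm.comp (measurable_snd.prodMk
        (measurable_snd.comp measurable_fst)))).ennreal_ofReal).pow_const p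
    have hFm : Measurable F := hFm'.lintegral_prod_right'
    -- the exceptional set of times can be chosen independent of almost every level
    have hae : ∀ᵐ t ∂(volume.restrict (Ioc (s - τ) s)), ∀ᵐ k ∂ν, F (k, t) ≤ Γ * I k := by
      refine (Measure.ae_ae_comm (μ := ν) (ν := volume.restrict (Ioc (s - τ) s))
        (p := fun k t => F (k, t) ≤ Γ * I k)
        (measurableSet_le hFm ((hIm.comp measurable_fst).const_mul _))).1 (ae_of_all _ fun k => ?_)
      exact h.slice R T ρ τ k hρ hρR hR hτ hτT hT
    filter_upwards [hae] with t ht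
    have hswap : AEMeasurable (Function.uncurry fun (x : Eucl N) (k : ℝ) =>
        ENNReal.ofReal (k - v (x, t)) ^ p) ((volume.restrict (cube y ρ)).prod ν) :=
      (((measurable_snd.sub (hvm.comp (measurable_fst.prodMk
        measurable_const))).ennreal_ofReal).pow_const p).aemeasurable
    calc ∫⁻ x in cube y ρ, ENNReal.ofReal (ψ (v (x, t))) ^ p
        ≤ ∫⁻ x in cube y ρ, 2 ^ p * ∫⁻ k, ENNReal.ofReal (k - v (x, t)) ^ p ∂ν :=
          lintegral_mono fun x => (hsup _).2.1
      _ = 2 ^ p * ∫⁻ k, F (k, t) ∂ν := by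
          rw [lintegral_const_mul' _ _ (by finiteness), lintegral_lintegral_swap hswap]
      _ ≤ 2 ^ p * ∫⁻ k, Γ * I k ∂ν := mul_le_mul_right (lintegral_mono_ae ht) _
      _ ≤ 2 ^ p * (ENNReal.ofReal p * Γ * ∫⁻ z in cyl y s R T, ENNReal.ofReal (ψ (v z)) ^ p) := by
          gcongr
      _ = _ := by simp only [mul_assoc]
  · have hind : ∀ z k, (Ioi (v z)).indicator (fun _ => ‖D z‖ₑ ^ p) k
        = {z | v z < k}.indicator (fun z => ‖D z‖ₑ ^ p) z := fun z k => by
      by_cases hz : v z < k <;> simp [hz]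
    have hswap : AEMeasurable (Function.uncurry fun (z : SpaceTime N) (k : ℝ) =>
        {z | v z < k}.indicator (fun z => ‖D z‖ₑ ^ p) z)
        ((volume.restrict (cyl y s ρ τ)).prod ν) := by
      have h1 : Measurable fun q : SpaceTime N × ℝ =>
          {q : SpaceTime N × ℝ | v q.1 < q.2}.indicator (fun q => ‖D q.1‖ₑ ^ p) q :=
        ((h.measurable_grad.comp measurable_fst).enorm.pow_const p).indicator
          (measurableSet_lt (hvm.comp measurable_fst) measurable_snd)
      have h2 : (Function.uncurry fun (z : SpaceTime N) (k : ℝ) =>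
          {z | v z < k}.indicator (fun z => ‖D z‖ₑ ^ p) z) = fun q : SpaceTime N × ℝ =>
          {q : SpaceTime N × ℝ | v q.1 < q.2}.indicator (fun q => ‖D q.1‖ₑ ^ p) q := by
        funext q
        by_cases hq : v q.1 < q.2 <;> simp [hq, Function.uncurry]
      rw [h2]
      exact h1.aemeasurable
    calc ∫⁻ z in cyl y s ρ τ, ENNReal.ofReal (rightSlope ψ (v z)) ^ p * ‖D z‖ₑ ^ p
        ≤ ∫⁻ z in cyl y s ρ τ, (∫⁻ k, {z | v z < k}.indicator (fun z => ‖D z‖ₑ ^ p) z ∂ν) := by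
          refine lintegral_mono fun z => ?_
          simp only
          simp_rw [← hind]
          rw [lintegral_indicator_const measurableSet_Ioi, mul_comm]
          gcongr
          exact (hsup _).1
      _ = ∫⁻ k, (∫⁻ z in cyl y s ρ τ, {z | v z < k}.indicator (fun z => ‖D z‖ₑ ^ p) z) ∂ν :=
          lintegral_lintegral_swap hswap
      _ ≤ ∫⁻ k, Γ * I k ∂ν :=
          lintegral_mono fun k => h.grad R T ρ τ k hρ hρR hR hτ hτT hT
      _ ≤ _ := hIle

/-- Absorbs a constant `c ≤ w` into the `1 / (T - τ)` term of the energy inequality: since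
`T / (T - τ) ≥ 1`, the slice integral of `c ^ p` is at most `1 / (T - τ)` times that of `w ^ p` over
the cylinder. -/
lemma mul_volume_cube_le (hp : 1 < p) {w : SpaceTime N → ℝ} {c R T ρ τ : ℝ} (hρR : ρ ≤ R)
    (hτ : 0 < τ) (hτT : τ < T)
    (hw : ∀ᵐ z ∂(volume.restrict (cyl y s R T)), c ≤ w z) :
    ENNReal.ofReal c ^ p * volume (cube y ρ)
      ≤ ENNReal.ofReal (1 / (T - τ)) * ∫⁻ z in cyl y s R T, ENNReal.ofReal (w z) ^ p := by
  have hT0 : 0 < T - τ := by linarith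
  have h1 : ENNReal.ofReal c ^ p * (volume (cube y R) * ENNReal.ofReal T)
      ≤ ∫⁻ z in cyl y s R T, ENNReal.ofReal (w z) ^ p := by
    have hvol : volume (cyl y s R T) = volume (cube y R) * ENNReal.ofReal T := by
      rw [cyl, Measure.volume_eq_prod, Measure.prod_prod, Real.volume_Ioc, sub_sub_cancel]
    rw [← hvol, ← setLIntegral_const]
    refine lintegral_mono_ae ?_
    filter_upwards [hw] with z hz
    gcongr
  have h2 : 1 ≤ ENNReal.ofReal (1 / (T - τ)) * ENNReal.ofReal T := by
    rw [← ENNReal.ofReal_mul (by positivity), ENNReal.one_le_ofReal, one_div_mul_eq_div,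
      one_le_div hT0]
    linarith
  calc ENNReal.ofReal c ^ p * volume (cube y ρ)
      ≤ ENNReal.ofReal c ^ p * volume (cube y R) * 1 := by
        rw [mul_one]
        gcongr
        exact cube_mono y hρR
    _ ≤ ENNReal.ofReal c ^ p * volume (cube y R) *
          (ENNReal.ofReal (1 / (T - τ)) * ENNReal.ofReal T) := by gcongr
    _ = ENNReal.ofReal (1 / (T - τ)) *
          (ENNReal.ofReal c ^ p * (volume (cube y R) * ENNReal.ofReal T)) := by ring
    _ ≤ _ := by gcongr

/-- The energy inequality for `Ψ(v)`, with `Ψ` convex, nonincreasing and tending to a limit `c ≥ 0`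
at infinity. The limit `c` is split off and estimated directly. -/
lemma LevelEstimates.energyInequality (h : LevelEstimates p γ v D y s R₀ T₀) (hp : 1 < p)
    (hγ : 0 < γ) {Ψ : ℝ → ℝ} {c : ℝ} (hc : ConvexOn ℝ univ Ψ) (ha : Antitone Ψ) (hc0 : 0 ≤ c)
    (ht : Tendsto Ψ atTop (𝓝 c)) {R T ρ τ : ℝ} (hρ : 0 < ρ) (hρR : ρ < R) (hR : R ≤ R₀)
    (hτ : 0 < τ) (hτT : τ < T) (hT : T ≤ T₀) :
    EnergyInequality p (2 ^ (p - 1) * (2 ^ p * p * γ + 1) + p * γ) (fun z => Ψ (v z))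
      (fun z => (-rightSlope Ψ (v z)) • D z) y s R T ρ τ := by
  have hp0 : 0 < p := by linarith
  set ψ : ℝ → ℝ := fun r => Ψ r - c with hψ
  have hψc : ConvexOn ℝ univ ψ := by
    simp only [hψ, sub_eq_add_neg]
    exact hc.add_const (-c)
  have hψa : Antitone ψ := fun a b hab => sub_le_sub_right (ha hab) c
  have hψt : Tendsto ψ atTop (𝓝 0) := by simpa using ht.sub_const c
  have hψ0 : ∀ r, 0 ≤ ψ r := hψa.le_of_tendsto hψt
  have hslope : ∀ r, rightSlope Ψ r = rightSlope ψ r := fun r => by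
    rw [rightSlope, rightSlope, hψ, derivWithin_sub_const]
  have hs0 : ∀ r, 0 ≤ rightSlope ψ r := rightSlope_nonneg hψc hψa
  obtain ⟨hsl, hgr⟩ := h.energy_convex hp hψc hψa hψt hρ hρR hR hτ hτT hT
  set Γ := ENNReal.ofReal (γ / (R - ρ) ^ p + γ / (T - τ)) with hΓ
  set W := ∫⁻ z in cyl y s R T, ENNReal.ofReal (Ψ (v z)) ^ p with hW
  have hJ : ∫⁻ z in cyl y s R T, ENNReal.ofReal (ψ (v z)) ^ p ≤ W := by
    refine lintegral_mono fun z => ?_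
    simp only
    gcongr
    simp only [hψ]
    linarith
  have hvol := mul_volume_cube_le (y := y) (s := s) (w := fun z => Ψ (v z)) (c := c) hp hρR.le hτ hτT
    (ae_of_all _ fun z => by have := hψ0 (v z); simp only [hψ] at this; linarith)
  have hvm : ∀ t, Measurable fun x => v (x, t) := fun t =>
    h.measurable.comp measurable_prodMk_right
  have hess : essSup (fun t => ∫⁻ x in cube y ρ, ENNReal.ofReal (Ψ (v (x, t))) ^ p)
      (volume.restrict (Ioo (s - τ) s))
      ≤ 2 ^ (p - 1) * (2 ^ p * ENNReal.ofReal p * Γ * W + ENNReal.ofReal (1 / (T - τ)) * W) := by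
    rw [Measure.restrict_congr_set Ioo_ae_eq_Ioc]
    refine essSup_le_of_ae_le _ ?_
    filter_upwards [hsl] with t hsl
    have hψm : Measurable fun x => ENNReal.ofReal (ψ (v (x, t))) ^ p :=
      ((hψa.measurable.comp (hvm t)).ennreal_ofReal).pow_const p
    calc ∫⁻ x in cube y ρ, ENNReal.ofReal (Ψ (v (x, t))) ^ p
        ≤ ∫⁻ x in cube y ρ, 2 ^ (p - 1) *
            (ENNReal.ofReal (ψ (v (x, t))) ^ p + ENNReal.ofReal c ^ p) := by
          refine lintegral_mono fun x => ?_
          have h1 : ENNReal.ofReal (Ψ (v (x, t)))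
              = ENNReal.ofReal (ψ (v (x, t))) + ENNReal.ofReal c := by
            rw [← ENNReal.ofReal_add (hψ0 _) hc0]
            simp [hψ]
          simp only
          rw [h1]
          exact ENNReal.rpow_add_le_mul_rpow_add_rpow _ _ hp.le
      _ = 2 ^ (p - 1) * ((∫⁻ x in cube y ρ, ENNReal.ofReal (ψ (v (x, t))) ^ p)
            + ENNReal.ofReal c ^ p * volume (cube y ρ)) := by
          rw [lintegral_const_mul' _ _ (by finiteness), lintegral_add_left hψm, setLIntegral_const]
      _ ≤ _ := by
          gcongr
          exact hsl.trans (by gcongr)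
  have hgrad : ∫⁻ z in cyl y s ρ τ, ‖(-rightSlope Ψ (v z)) • D z‖ₑ ^ p
      ≤ ENNReal.ofReal p * Γ * W := by
    refine le_trans (le_of_eq (lintegral_congr fun z => ?_)) (hgr.trans (by gcongr))
    rw [enorm_smul, enorm_neg, hslope, Real.enorm_of_nonneg (hs0 _),
      ENNReal.mul_rpow_of_nonneg _ _ hp0.le]
  rw [EnergyInequality]
  refine (add_le_add hess hgrad).trans ?_
  have h1 : 0 < (R - ρ) ^ p := Real.rpow_pos_of_pos (by linarith) _
  have h2 : 0 < T - τ := by linarith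
  have e2 : (2 : ℝ≥0∞) ^ p = ENNReal.ofReal (2 ^ p) := by
    rw [← ENNReal.ofReal_rpow_of_pos two_pos]; simp
  have e3 : (2 : ℝ≥0∞) ^ (p - 1) = ENNReal.ofReal (2 ^ (p - 1)) := by
    rw [← ENNReal.ofReal_rpow_of_pos two_pos]; simp
  calc _ = (2 ^ (p - 1) * (2 ^ p * ENNReal.ofReal p * Γ + ENNReal.ofReal (1 / (T - τ)))
          + ENNReal.ofReal p * Γ) * W := by ring
    _ ≤ _ := by
        refine mul_le_mul_left ?_ W
        rw [e2, e3, hΓ, ← ENNReal.ofReal_mul (by positivity), ← ENNReal.ofReal_mul (by positivity),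
          ← ENNReal.ofReal_add (by positivity) (by positivity), ← ENNReal.ofReal_mul (by positivity),
          ← ENNReal.ofReal_mul (by positivity), ← ENNReal.ofReal_add (by positivity) (by positivity)]
        refine ENNReal.ofReal_le_ofReal ?_
        have h3 : 0 ≤ 2 ^ (p - 1) * (1 / (R - ρ) ^ p) := by positivity
        calc _ = (2 ^ (p - 1) * (2 ^ p * p * γ + 1) + p * γ) / (R - ρ) ^ p
              + (2 ^ (p - 1) * (2 ^ p * p * γ + 1) + p * γ) / (T - τ)
              - 2 ^ (p - 1) * (1 / (R - ρ) ^ p) := by ring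
          _ ≤ _ := by linarith

end

/-- A convex nonincreasing function on an open half-line agrees on `[b, ∞)` with a convex
nonincreasing Lipschitz function on the whole line: the supremum of its tangents at points of
`[b, ∞)`. -/
lemma exists_convex_extension {φ : ℝ → ℝ} {S : Set ℝ} (hc : ConvexOn ℝ S φ) (ha : AntitoneOn φ S)
    {b : ℝ} (hb : Ici b ⊆ interior S) :
    ∃ (Φ : ℝ → ℝ) (L : ℝ≥0), ConvexOn ℝ univ Φ ∧ Antitone Φ ∧ LipschitzWith L Φ ∧
      ∀ r, b ≤ r → Φ r = φ r := by
  set l : Ici b → ℝ → ℝ := fun k r => φ k + rightSlope φ k * (k - r) with hl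
  have hbi : b ∈ interior S := hb self_mem_Ici
  have hki : ∀ k : Ici b, (k : ℝ) ∈ interior S := fun k => hb k.2
  have hs0 : ∀ k : Ici b, 0 ≤ rightSlope φ k := by
    intro k
    have h1 : (k : ℝ) + 1 ∈ interior S := hb (mem_Ici.2 (by have := mem_Ici.1 k.2; linarith))
    have h2 := hc.rightDeriv_le_slope_of_mem_interior (hki k) (interior_subset h1) (by linarith)
    have h3 := ha (interior_subset (hki k)) (interior_subset h1) (by linarith)
    rw [slope_def_field, add_sub_cancel_left, div_one] at h2
    rw [rightSlope]
    linarith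
  have hsb : ∀ k : Ici b, rightSlope φ k ≤ rightSlope φ b := fun k =>
    neg_le_neg (hc.monotoneOn_rightDeriv hbi (hki k) k.2)
  set L : ℝ≥0 := ⟨rightSlope φ b, hs0 ⟨b, self_mem_Ici⟩⟩ with hL
  have hlip : ∀ k r r', l k r ≤ l k r' + L * dist r r' := by
    intro k r r'
    have h1 : r' - r ≤ dist r r' := by rw [Real.dist_eq, abs_sub_comm]; exact le_abs_self _
    have h2 : rightSlope φ k * (r' - r) ≤ L * dist r r' :=
      (mul_le_mul_of_nonneg_left h1 (hs0 k)).trans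
        (mul_le_mul_of_nonneg_right (hsb k) dist_nonneg)
    have h3 : l k r = l k r' + rightSlope φ k * (r' - r) := by simp only [hl]; ring
    linarith
  have hlb : ∀ k r, b ≤ r → l k r ≤ φ r := fun k r hr =>
    tangent_le_of_mem_interior hc (hki k) (interior_subset (hb hr))
  have hbdd : ∀ r, BddAbove (range fun k => l k r) := by
    intro r
    refine ⟨φ b + L * dist r b, ?_⟩
    rintro _ ⟨k, rfl⟩
    exact (hlip k r b).trans (add_le_add_left (hlb k b le_rfl) _)
  have : Nonempty (Ici b) := ⟨⟨b, self_mem_Ici⟩⟩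
  set Φ : ℝ → ℝ := fun r => ⨆ k, l k r with hΦ
  have hle : ∀ k r, l k r ≤ Φ r := fun k r => le_ciSup (hbdd r) k
  refine ⟨Φ, L, ⟨convex_univ, fun x _ z _ α β hα hβ hαβ => ?_⟩, fun x z hxz => ?_, ?_,
    fun r hr => le_antisymm (ciSup_le fun k => hlb k r hr) ?_⟩
  · refine ciSup_le fun k => ?_
    have h1 : l k (α • x + β • z) = α * l k x + β * l k z := by
      have : α = 1 - β := by linarith
      simp only [hl, smul_eq_mul, this]
      ring
    rw [h1]
    exact add_le_add (mul_le_mul_of_nonneg_left (hle k x) hα)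
      (mul_le_mul_of_nonneg_left (hle k z) hβ)
  · refine ciSup_le fun k => le_trans ?_ (hle k x)
    have := hs0 k
    simp only [hl]
    gcongr
  · exact LipschitzWith.of_le_add_mul L fun r r' =>
      ciSup_le fun k => (hlip k r r').trans (add_le_add_left (hle k r') _)
  · have := hle ⟨r, hr⟩ r
    simpa [hl] using this

/-! ### Membership of the composition in the generalized class -/

/-- The composition of a member of `𝔄_p^-` with a convex nonincreasing function vanishing at infinity
belongs to the generalized class `𝔄_p^+`, with a constant quantity. -/
lemma ClassAMinus.generalizedClassAPlus {N : ℕ} {p γ : ℝ} (hp : 1 < p) (hγ : 0 < γ)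
    {E : Set (SpaceTime N)} (hE : IsOpen E) {a : EReal} (ha : a < ⊤) {φ : ℝ → ℝ}
    (hc : ConvexOn ℝ {k : ℝ | a < (k : EReal)} φ) (hanti : AntitoneOn φ {k : ℝ | a < (k : EReal)})
    (hφ : Tendsto φ atTop (𝓝 0)) {u : SpaceTime N → ℝ} (hu : ClassAMinus p γ E u)
    (hua : ∀ᵐ z ∂(volume.restrict E), a < (u z : EReal)) :
    GeneralizedClassAPlus p (fun _ _ _ _ => 2 ^ (p - 1) * (2 ^ p * p * γ + 1) + p * γ) E
      (fun z => φ (u z)) := by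
  set S := {k : ℝ | a < (k : EReal)} with hS
  have hSo : IsOpen S := isOpen_lt continuous_const continuous_coe_real_ereal
  -- locally, `φ(u)` is a Lipschitz convex function of a function satisfying the level estimates
  have key : ∀ (y : Eucl N) (s R T : ℝ), 0 < R → 0 < T → closure (cyl y s R T) ⊆ E →
      ∃ (v : SpaceTime N → ℝ) (D : SpaceTime N → Eucl N) (R₀ T₀ b : ℝ) (Φ : ℝ → ℝ) (L : ℝ≥0),
        LevelEstimates p γ v D y s R₀ T₀ ∧ R ≤ R₀ ∧ T ≤ T₀ ∧
        (∀ᵐ z ∂(volume.restrict (cyl y s R T)), b ≤ v z ∧ φ (u z) = Φ (v z)) ∧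
        ConvexOn ℝ univ Φ ∧ Antitone Φ ∧ LipschitzWith L Φ ∧ Tendsto Φ atTop (𝓝 0) := by
    intro y s R T hR hT hcl
    obtain ⟨R', T', hRR, hTT, hcl'⟩ := exists_larger_cyl hR hT hE hcl
    obtain ⟨v, D, huv, hv⟩ := hu.exists_levelEstimates hp (hR.trans hRR) (hT.trans hTT) hcl'
    have hva : ∀ᵐ z ∂(volume.restrict (cyl y s R' T')), a < (v z : EReal) := by
      filter_upwards [huv, ae_mono (Measure.restrict_mono (subset_closure.trans hcl') le_rfl) hua]
        with z h1 h2
      rwa [← h1]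
    obtain ⟨b, hab, hb⟩ := hv.exists_ae_ge hp hγ hR hRR hT hTT ha hva
    obtain ⟨Φ, L, hΦc, hΦa, hΦL, hΦ⟩ := exists_convex_extension hc hanti (b := b) (by
      rw [hSo.interior_eq]
      exact fun k hk => hab.trans_le (EReal.coe_le_coe_iff.2 hk))
    refine ⟨v, D, R', T', b, Φ, L, hv, hRR.le, hTT.le, ?_, hΦc, hΦa, hΦL,
      hφ.congr' ((eventually_ge_atTop b).mono fun r hr => (hΦ r hr).symm)⟩
    filter_upwards [hb, ae_mono (Measure.restrict_mono (cyl_mono y s hRR.le hTT.le) le_rfl) huv]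
      with z h1 h2
    exact ⟨h1, by rw [h2, hΦ _ h1]⟩
  refine ⟨?_, ?_, ?_⟩
  · have hm : Measurable (S.indicator φ) := by
      classical
      have := ContinuousOn.measurable_piecewise (s := S) (f := φ) (g := (0 : ℝ → ℝ))
        (hc.continuousOn hSo) continuous_zero.continuousOn hSo.measurableSet
      rwa [piecewise_eq_indicator] at this
    refine (hm.comp_aemeasurable hu.measurable).congr ?_
    filter_upwards [hua] with z hz
    exact indicator_of_mem (s := S) hz φ
  · intro y s R T hR hT hcl
    obtain ⟨v, D, R₀, T₀, b, Φ, L, hv, hR₀, hT₀, hae, hΦc, hΦa, hΦL, hΦt⟩ := key y s R T hR hT hcl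
    have hΦ0 : ∀ r, 0 ≤ Φ r := hΦa.le_of_tendsto hΦt
    refine ⟨?_, _, ((hv.hasSpatialGradient.mono hR₀ hT₀).comp_lipschitz hp.le hΦL
      (hasDerivWithinAt_rightSlope hΦc)).congr (hae.mono fun z hz => hz.2.symm) (ae_eq_refl _)⟩
    have hle : essSup (fun t => ∫⁻ x in cube y R, ‖φ (u (x, t))‖ₑ ^ p)
        (volume.restrict (Ioo (s - T) s)) ≤ ENNReal.ofReal (Φ b) ^ p * volume (cube y R) := by
      rw [Measure.restrict_congr_set Ioo_ae_eq_Ioc]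
      refine essSup_le_of_ae_le _ ?_
      filter_upwards [ae_slice hae] with t ht
      rw [← setLIntegral_const]
      refine lintegral_mono_ae ?_
      filter_upwards [ht] with x hx
      rw [hx.2, Real.enorm_of_nonneg (hΦ0 _)]
      have := hΦa hx.1
      gcongr
    refine hle.trans_lt (ENNReal.mul_lt_top ?_ (volume_cube_lt_top y R))
    exact ENNReal.rpow_lt_top_of_nonneg (by linarith) ENNReal.ofReal_ne_top
  · intro y s R T hR hT hcl k
    obtain ⟨v, D, R₀, T₀, b, Φ, L, hv, hR₀, hT₀, hae, hΦc, hΦa, hΦL, hΦt⟩ := key y s R T hR hT hcl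
    set Ψ : ℝ → ℝ := fun r => (Φ r - k)⁺ with hΨ
    have hΨc : ConvexOn ℝ univ Ψ := by
      have h1 : ConvexOn ℝ univ fun r => Φ r - k := by
        simp only [sub_eq_add_neg]
        exact hΦc.add_const (-k)
      exact h1.sup (convexOn_const 0 convex_univ)
    have hΨa : Antitone Ψ := fun x z hxz => posPart_mono (sub_le_sub_right (hΦa hxz) k)
    have hΨL : LipschitzWith L Ψ := by
      refine LipschitzWith.of_le_add_mul L fun x z => ?_
      have h1 := hΦL.le_add_mul x z
      have h2 : (0 : ℝ) ≤ L * dist x z := by positivity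
      simp only [hΨ, posPart_def]
      refine sup_le ?_ ?_
      · have := le_sup_left (a := Φ z - k) (b := (0 : ℝ))
        linarith
      · have := le_sup_right (a := Φ z - k) (b := (0 : ℝ))
        linarith
    have hΨt : Tendsto Ψ atTop (𝓝 (0 - k)⁺) := by
      simp only [hΨ, posPart_def]
      exact (hΦt.sub_const k).max tendsto_const_nhds
    have heq : (fun z => Ψ (v z)) =ᵐ[volume.restrict (cyl y s R T)] fun z => (φ (u z) - k)⁺ :=
      hae.mono fun z hz => by simp only [hΨ]; rw [hz.2]
    refine ⟨_, ((hv.hasSpatialGradient.mono hR₀ hT₀).comp_lipschitz hp.le hΨL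
      (hasDerivWithinAt_rightSlope hΨc)).congr heq (ae_eq_refl _), ?_⟩
    intro ρ τ hρ hρR hτ hτT
    have hen := hv.energyInequality hp hγ hΨc hΨa (posPart_nonneg _) hΨt hρ hρR hR₀ hτ hτT hT₀
    rw [EnergyInequality] at hen ⊢
    have h1 : ∫⁻ z in cyl y s R T, ENNReal.ofReal (φ (u z) - k)⁺ ^ p
        = ∫⁻ z in cyl y s R T, ENNReal.ofReal (Ψ (v z)) ^ p :=
      lintegral_congr_ae (heq.mono fun z hz => by simp only [← hz])
    have h2 : essSup (fun t => ∫⁻ x in cube y ρ, ENNReal.ofReal (φ (u (x, t)) - k)⁺ ^ p)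
          (volume.restrict (Ioo (s - τ) s))
        = essSup (fun t => ∫⁻ x in cube y ρ, ENNReal.ofReal (Ψ (v (x, t))) ^ p)
          (volume.restrict (Ioo (s - τ) s)) := by
      rw [Measure.restrict_congr_set Ioo_ae_eq_Ioc]
      refine essSup_congr_ae ?_
      have h3 := ae_mono (Measure.restrict_mono (cyl_mono y s hρR.le hτT.le) le_rfl) heq
      filter_upwards [ae_slice h3] with t ht
      exact lintegral_congr_ae (ht.mono fun x hx => by simp only [← hx])
    rw [h1, h2]
    exact hen

end ParabolicDeGiorgi

/-- The homogeneous quantity `A` depends on `N`, `p`, `γ` only. The derivative of the convex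
function `φ` is its right derivative, which exists everywhere and is `φ'` where that exists. -/
theorem lemma3p2 (N : ℕ) (hN : 1 ≤ N) (p γ : ℝ) (hp : 1 < p) (hγ : 0 < γ) :
    ∃ A : ℝ → ℝ → ℝ → ℝ → ℝ, ParabolicDeGiorgi.IsHomogeneousQuantity p A ∧
      ∀ (E : Set (ParabolicDeGiorgi.SpaceTime N)), IsOpen E →
      ∀ (a : EReal), a < ⊤ →
      ∀ (φ : ℝ → ℝ), ConvexOn ℝ {k : ℝ | a < (k : EReal)} φ →
        AntitoneOn φ {k : ℝ | a < (k : EReal)} →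
        Filter.Tendsto φ Filter.atTop (nhds 0) →
        Filter.Tendsto (fun k : ℝ => k * derivWithin φ (Set.Ioi k) k) Filter.atTop (nhds 0) →
      ∀ (u : ParabolicDeGiorgi.SpaceTime N → ℝ),
        ParabolicDeGiorgi.ClassAMinus p γ E u →
        (∀ᵐ z ∂(MeasureTheory.volume.restrict E), a < (u z : EReal)) →
        ParabolicDeGiorgi.GeneralizedClassAPlus p A E (fun z => φ (u z)) := by
  have hA : 0 < 2 ^ (p - 1) * (2 ^ p * p * γ + 1) + p * γ := by
    have : 0 < p := by linarith
    positivity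
  exact ⟨fun _ _ _ _ => 2 ^ (p - 1) * (2 ^ p * p * γ + 1) + p * γ,
    ⟨fun _ _ _ _ _ _ _ _ => hA, ⟨fun _ _ => _, fun _ _ _ _ _ _ _ _ => rfl⟩⟩,
    fun _ hE _ ha _ hc hanti hφ _ _ hu hua =>
      hu.generalizedClassAPlus hp hγ hE ha hc hanti hφ hua⟩
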